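/- Notation. For a system $f_1,\dots,f_n$ of $n$ linearly independent vectors in $\mathbb{E}^n$, the hyperplanes $f_i^\perp$ decompose the unit sphere $S^{n-1}$ into the $2^n$ simplices $\{x\in S^{n-1} : \langle \varepsilon_i f_i,x\rangle\le 0 \text{ for all } i\}$, $\varepsilon\in\{\pm1\}^n$. The set of these simplices is called a family of simplices in $S^{n-1}$, represented by the vectors $\pm f_1,\dots,\pm f_n$. A family $\Phi$ is said to generate $A_n$ (respectively $B_n$) if the group generated by the reflections of $\mathbb{E}^n$ in the hyperplanes bounding its simplices is the group generated by the reflections in the facets of some spherical Coxeter simplex whose Coxeter diagram is $A_n$ (respectively $B_n$). Let $$\Delta(A_n)=\{\pm(h_i-h_j) : 0\le i<j\le n\}\subset\mathbb{E}^{n+1},\qquad \Delta(B_n)=\{\pm h_i : 1\le i\le n\}\cup\{\pm h_i\pm h_j : 1\le i<j\le n\}\subset\mathbb{E}^{n},$$ where the $h_i$ form the standard basis. The Weyl group of a root system $\Delta$ is the group generated by the reflections in the hyperplanes orthogonal to the roots of $\Delta$. An embedding of $\Phi$ into $\Delta$ is a set $\{\pm r_1,\dots,\pm r_n\}\subseteq\Delta$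 (the $r_i$ being neither ordered nor signed) such that $r_i=\varphi(f_i)$ for all $i$, for some linear isometric embedding $\varphi$ of $\mathbb{E}^n$ into the Euclidean space containing $\Delta$ and some vectors $\pm f_1,\dots,\pm f_n$ representing $\Phi$. Statement. (1) Let $n\ge 1$ and let $\Phi$ be a family of simplices in $S^{n-1}$ generating $A_n$. Then there exists an embedding of $\Phi$ into $\Delta(A_n)$, and it is unique up to the action of the Weyl group of $A_n$. (2) Let $n\ge 2$ and let $\Phi$ be a family of simplices in $S^{n-1}$ generating $B_n$. Then there exists an embedding of $\Phi$ into $\Delta(B_n)$, and it is unique up to the action of the Weyl group of $B_n$. -/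

import Mathlib

namespace SphericalFamily

/-- The Euclidean space `𝔼ⁿ`; its unit sphere is `Sⁿ⁻¹`. -/
abbrev E (n : ℕ) : Type := EuclideanSpace ℝ (Fin n)

/-- The reflection of `𝔼ᵐ` in the hyperplane orthogonal to `v`. -/
noncomputable def refl {m : ℕ} (v : E m) : E m ≃ₗᵢ[ℝ] E m :=
  Submodule.reflection (Submodule.span ℝ {v})ᗮ

/-- The spherical simplex in `Sⁿ⁻¹` with outward facet normals `f i`
(a simplex when the `f i` are linearly independent; the normals need not be of unit length). -/
def simplex {n : ℕ} (f : Fin n → E n) : Set (E n) :=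
  {x | x ∈ Metric.sphere (0 : E n) 1 ∧ ∀ i, inner ℝ (f i) x ≤ 0}

/-- The set of the simplices into which the hyperplanes orthogonal to the vectors `f i`
decompose the sphere: one for each choice of signs in `± f i`. -/
def familyOf {n : ℕ} (f : Fin n → E n) : Set (Set (E n)) :=
  Set.range fun ε : Fin n → ℤˣ => simplex fun i => ((ε i : ℤ) : ℝ) • f i

/-- `Φ` is the family of simplices represented by the (suitably normalized) vectors `± f i`. -/
def IsRepresentedBy {n : ℕ} (Φ : Set (Set (E n))) (f : Fin n → E n) : Prop :=
  LinearIndependent ℝ f ∧ Φ = familyOf f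

/-- `Φ` is a family of spherical simplices in `Sⁿ⁻¹`. -/
def IsFamily {n : ℕ} (Φ : Set (Set (E n))) : Prop :=
  ∃ f : Fin n → E n, IsRepresentedBy Φ f

/-- The group generated by the reflections in the hyperplanes bounding the simplices of `Φ`. -/
noncomputable def generatedGroup {n : ℕ} (Φ : Set (Set (E n))) : Subgroup (E n ≃ₗᵢ[ℝ] E n) :=
  Subgroup.closure {s | ∃ f : Fin n → E n, IsRepresentedBy Φ f ∧ ∃ i, s = refl (f i)}

/-- `e` is the system of unit outward normals of a spherical Coxeter simplex of type `M`:
its `i`-th and `j`-th facets form the dihedral angle `π / M i j`. On the diagonal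
`M i i = 1`, and the condition says that `e i` is a unit vector. -/
def IsCoxeterSimplex {n : ℕ} (M : CoxeterMatrix (Fin n)) (e : Fin n → E n) : Prop :=
  LinearIndependent ℝ e ∧ ∀ i j, inner ℝ (e i) (e j) = -Real.cos (Real.pi / (M i j : ℝ))

/-- The family `Φ` generates the reflection group of type `M`, that is, the group generated by
the reflections in the facets of some Coxeter simplex of type `M`. -/
def Generates {n : ℕ} (Φ : Set (Set (E n))) (M : CoxeterMatrix (Fin n)) : Prop :=
  ∃ e : Fin n → E n, IsCoxeterSimplex M e ∧
    generatedGroup Φ = Subgroup.closure (Set.range fun i => refl (e i))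

/-- The standard basis of `𝔼ᵐ`. -/
noncomputable def h {m : ℕ} (i : Fin m) : E m := EuclideanSpace.single i 1

/-- The root system `Δ(Aₙ) = {±(h_i - h_j) : 0 ≤ i < j ≤ n}` in `𝔼ⁿ⁺¹`. -/
def rootsA (n : ℕ) : Set (E (n + 1)) :=
  {r | ∃ i j : Fin (n + 1), i < j ∧ (r = h i - h j ∨ r = -(h i - h j))}

/-- The root system `Δ(Bₙ) = {± h_i} ∪ {± h_i ± h_j : i < j}` in `𝔼ⁿ`. -/
def rootsB (n : ℕ) : Set (E n) :=
  {r | (∃ i : Fin n, r = h i ∨ r = -h i) ∨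
    ∃ i j : Fin n, i < j ∧
      (r = h i + h j ∨ r = h i - h j ∨ r = -h i + h j ∨ r = -h i - h j)}

/-- The Weyl group of a root system `Δ` in `𝔼ᵐ`. -/
noncomputable def weylGroup {m : ℕ} (Δ : Set (E m)) : Subgroup (E m ≃ₗᵢ[ℝ] E m) :=
  Subgroup.closure (refl '' Δ)

/-- `R = {± f₁, …, ± fₙ} ⊆ Δ` is an embedding of the family `Φ` into the root system `Δ`:
up to an isometry, `Φ` is represented by the vectors `± f₁, …, ± fₙ` chosen from `Δ`.
The vectors are neither ordered nor signed. -/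
def IsEmbedding {n m : ℕ} (Φ : Set (Set (E n))) (Δ R : Set (E m)) : Prop :=
  R ⊆ Δ ∧ ∃ (φ : E n →ₗᵢ[ℝ] E m) (f : Fin n → E n),
    IsRepresentedBy Φ f ∧ R = {r | ∃ i, r = φ (f i) ∨ r = -φ (f i)}

/-- There is exactly one embedding of `Φ` into `Δ` up to the action of the Weyl group. -/
def HasUniqueEmbedding {n m : ℕ} (Φ : Set (Set (E n))) (Δ : Set (E m)) : Prop :=
  ∃ R : Set (E m), IsEmbedding Φ Δ R ∧
    ∀ R' : Set (E m), IsEmbedding Φ Δ R' → ∃ w ∈ weylGroup Δ, R' = w '' R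

end SphericalFamily

/-! A family determines its representing vectors up to order and nonzero factors: the points lying
in two simplices form the union of the hyperplanes, and a real vector space is not a finite union of
proper subspaces (`IsRepresentedBy.exists_perm`). Hence `generatedGroup` is generated by the
reflections in any one representing system.

Existence. The normals of a Coxeter simplex have the Gram matrix of normalized simple roots, so an
isometry carries the generated group into the Weyl group. That group permutes the `h k`, up to sign
in type B. A reflection taking `h k` to a different `± h j` has normal proportional to `h k ∓ h j`,
so every `f i` can be rescaled to a root.

Uniqueness, type A. All roots have the same length, so two embeddings use the same vectors up to
sign. Any `n` independent roots generate the root lattice, so each `h 0 - h j` is sent to an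
integral vector of norm √2 with coordinate sum zero, again a root. The images have pairwise inner
product 1, so they all share their positive index or all share their negative one; the map is a
permutation of coordinates or minus one, and the sign is invisible in the set.

Uniqueness, type B. Now factors other than ±1 must be handled. The `f i` form an irreducible system,
and a parity argument shows that some root is short (`exists_mem_shortB`). Together these make the
roots generate `ℤⁿ`, whose isometries are signed permutations. Non-orthogonal, non-proportional
roots have inner product ±1, so irreducibility forces the factors to be all ±1 or never ±1. In the
latter case short and long roots trade places; as each system has only one short root, `n = 2`, and
interchanging the two vectors repairs the lengths. -/

namespace SphericalFamily

/-! ### Reflections -/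

theorem refl_apply {m : ℕ} (v x : E m) :
    refl v x = x - (2 * inner ℝ v x / ‖v‖ ^ 2) • v := by
  rw [refl, Submodule.reflection_orthogonal_apply, Submodule.reflection_singleton_apply]
  simp only [RCLike.ofReal_real_eq_id, id_eq, mul_div_assoc, mul_smul, neg_sub]
  rw [two_smul, two_smul]

theorem refl_smul {m : ℕ} {c : ℝ} (hc : c ≠ 0) (v : E m) : refl (c • v) = refl v := by
  have : Submodule.span ℝ {c • v} = Submodule.span ℝ {v} :=
    Submodule.span_singleton_smul_eq (IsUnit.mk0 c hc) v
  simp only [refl, this]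

theorem map_refl {n m : ℕ} (φ : E n →ₗᵢ[ℝ] E m) (v x : E n) :
    φ (refl v x) = refl (φ v) (φ x) := by
  simp [refl_apply]

/-- An isometric embedding taking the vectors `v i` to roots intertwines the group generated by
the reflections in the `v i` with the Weyl group. -/
theorem exists_weylGroup_intertwining {n m : ℕ} (φ : E n →ₗᵢ[ℝ] E m) {Δ : Set (E m)}
    {S : Set (E n ≃ₗᵢ[ℝ] E n)} (hS : ∀ s ∈ S, ∃ v, s = refl v ∧ φ v ∈ Δ)
    {g : E n ≃ₗᵢ[ℝ] E n} (hg : g ∈ Subgroup.closure S) :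
    ∃ w ∈ weylGroup Δ, ∀ x, φ (g x) = w (φ x) := by
  induction hg using Subgroup.closure_induction with
  | mem s hs =>
    obtain ⟨v, rfl, hv⟩ := hS s hs
    exact ⟨refl (φ v), Subgroup.subset_closure ⟨_, hv, rfl⟩, map_refl φ v⟩
  | one => exact ⟨1, one_mem _, fun x => rfl⟩
  | mul a b _ _ ha hb =>
    obtain ⟨u, hu, hu'⟩ := ha
    obtain ⟨w, hw, hw'⟩ := hb
    exact ⟨u * w, mul_mem hu hw, fun x => by
      change φ (a (b x)) = u (w (φ x))
      rw [hu', hw']⟩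
  | inv a _ ha =>
    obtain ⟨u, hu, hu'⟩ := ha
    refine ⟨u⁻¹, inv_mem hu, fun x => ?_⟩
    have h1 := hu' (a⁻¹ x)
    have h2 : a (a⁻¹ x) = x := a.apply_symm_apply x
    rw [h2] at h1
    rw [h1]
    exact (u.symm_apply_apply _).symm

/-- A reflection moving `x` to `x' ≠ x` is the reflection in the hyperplane orthogonal to
`x - x'`. -/
theorem exists_smul_eq_sub_of_refl_eq {m : ℕ} {v x x' : E m} (hx : refl v x = x')
    (hv : inner ℝ v x ≠ 0) : ∃ c : ℝ, c ≠ 0 ∧ c • v = x - x' := by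
  have hv0 : v ≠ 0 := by rintro rfl; simp at hv
  refine ⟨2 * inner ℝ v x / ‖v‖ ^ 2, ?_, ?_⟩
  · have := norm_ne_zero_iff.mpr hv0
    positivity
  · rw [← hx, refl_apply]; abel

/-! ### Linearly independent systems -/

theorem span_range_eq_top {n : ℕ} {f : Fin n → E n} (hf : LinearIndependent ℝ f) :
    Submodule.span ℝ (Set.range f) = ⊤ := by
  apply hf.span_eq_top_of_card_eq_finrank'
  simp

theorem eq_zero_of_forall_inner_eq_zero {n : ℕ} {f : Fin n → E n} (hf : LinearIndependent ℝ f)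
    {y : E n} (hy : ∀ k, inner ℝ (f k) y = 0) : y = 0 := by
  have : y ∈ (Submodule.span ℝ (Set.range f))ᗮ := by
    rw [Submodule.mem_orthogonal]
    intro u hu
    induction hu using Submodule.span_induction with
    | mem x hx => obtain ⟨k, rfl⟩ := hx; exact hy k
    | zero => simp
    | add a b _ _ ha hb => rw [inner_add_left, ha, hb, add_zero]
    | smul c a _ ha => rw [real_inner_smul_left, ha, mul_zero]
  rwa [span_range_eq_top hf, Submodule.top_orthogonal_eq_bot, Submodule.mem_bot] at this

theorem exists_inner_eq {n : ℕ} {f : Fin n → E n} (hf : LinearIndependent ℝ f) (a : Fin n → ℝ) :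
    ∃ y : E n, ∀ k, inner ℝ (f k) y = a k := by
  let T : E n →ₗ[ℝ] (Fin n → ℝ) := LinearMap.pi fun k => (innerSL ℝ (f k)).toLinearMap
  have hT : Function.Injective T := by
    rw [injective_iff_map_eq_zero]
    intro y hy
    exact eq_zero_of_forall_inner_eq_zero hf fun k => congrFun hy k
  obtain ⟨y, hy⟩ := (LinearMap.injective_iff_surjective_of_finrank_eq_finrank (by simp)).mp hT a
  exact ⟨y, fun k => congrFun hy k⟩

/-- A basis of `𝔼ⁿ` can be mapped isometrically to any system with the same Gram matrix. -/
theorem exists_linearIsometry_of_gram {n m : ℕ} {e : Fin n → E n} (he : LinearIndependent ℝ e)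
    (u : Fin n → E m) (hu : ∀ i j, inner ℝ (u i) (u j) = inner ℝ (e i) (e j)) :
    ∃ φ : E n →ₗᵢ[ℝ] E m, ∀ i, φ (e i) = u i := by
  let b := Module.Basis.mk he (span_range_eq_top he).ge
  have hb : ∀ i, b i = e i := fun i => by simp [b]
  simp only [← hb] at hu ⊢
  refine ⟨(b.constr ℝ u).isometryOfInner fun x y => ?_, fun i => ?_⟩
  · rw [← b.sum_repr x, ← b.sum_repr y]
    simp only [map_sum, map_smul, Module.Basis.constr_basis, sum_inner, inner_sum,
      real_inner_smul_left, real_inner_smul_right, hu]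
  · simp

/-! ### Families of simplices and the vectors representing them -/

theorem mem_simplex_sign {n : ℕ} {f : Fin n → E n} {ε : Fin n → ℤˣ} {x : E n} :
    x ∈ simplex (fun i => ((ε i : ℤ) : ℝ) • f i) ↔
      x ∈ Metric.sphere (0 : E n) 1 ∧ ∀ i, ((ε i : ℤ) : ℝ) * inner ℝ (f i) x ≤ 0 := by
  simp only [simplex, Set.mem_ofPred_eq, real_inner_smul_left]

theorem sign_cases (u : ℤˣ) : ((u : ℤ) : ℝ) = 1 ∨ ((u : ℤ) : ℝ) = -1 := by
  rcases Int.units_eq_one_or u with rfl | rfl <;> simp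

/-- A negative factor is absorbed by flipping the sign at that index. -/
theorem familyOf_smul_subset {n : ℕ} (f : Fin n → E n) {c : Fin n → ℝ} (hc : ∀ i, c i ≠ 0) :
    familyOf (fun i => c i • f i) ⊆ familyOf f := by
  rintro _ ⟨ε, rfl⟩
  refine ⟨fun i => if 0 < c i then ε i else -ε i, ?_⟩
  ext x
  simp only [mem_simplex_sign, real_inner_smul_left]
  refine and_congr_right fun _ => forall_congr' fun i => ?_
  split_ifs with h
  · constructor
    · intro hh; nlinarith
    · intro hh; by_contra! h2; nlinarith
  · have h' : c i < 0 := lt_of_le_of_ne (not_lt.mp h) (hc i)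
    push_cast
    constructor
    · intro hh; nlinarith
    · intro hh; by_contra! h2; nlinarith

theorem familyOf_smul {n : ℕ} (f : Fin n → E n) {c : Fin n → ℝ} (hc : ∀ i, c i ≠ 0) :
    familyOf (fun i => c i • f i) = familyOf f := by
  refine (familyOf_smul_subset f hc).antisymm ?_
  have := familyOf_smul_subset (fun i => c i • f i) (c := fun i => (c i)⁻¹)
    fun i => inv_ne_zero (hc i)
  simpa [smul_smul, hc] using this

theorem IsRepresentedBy.smul {n : ℕ} {Φ : Set (Set (E n))} {f : Fin n → E n}
    (hf : IsRepresentedBy Φ f) {c : Fin n → ℝ} (hc : ∀ i, c i ≠ 0) :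
    IsRepresentedBy Φ fun i => c i • f i :=
  ⟨hf.1.units_smul fun i => Units.mk0 (c i) (hc i), by rw [familyOf_smul f hc, hf.2]⟩

/-- A point of the sphere belongs to two different simplices of a family if and only if it lies
on one of the hyperplanes. -/
theorem IsRepresentedBy.mem_two_iff {n : ℕ} {Φ : Set (Set (E n))} {f : Fin n → E n}
    (hf : IsRepresentedBy Φ f) {x : E n} (hx : x ∈ Metric.sphere (0 : E n) 1) :
    (∃ S ∈ Φ, ∃ T ∈ Φ, S ≠ T ∧ x ∈ S ∧ x ∈ T) ↔ ∃ i, inner ℝ (f i) x = 0 := by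
  obtain ⟨hli, rfl⟩ := hf
  constructor
  · rintro ⟨_, ⟨ε, rfl⟩, _, ⟨η, rfl⟩, hne, hS, hT⟩
    by_contra! h0
    refine hne ?_
    have : ε = η := by
      funext i
      have h1 := (mem_simplex_sign.mp hS).2 i
      have h2 := (mem_simplex_sign.mp hT).2 i
      rcases Int.units_eq_one_or (ε i) with he | he <;>
        rcases Int.units_eq_one_or (η i) with hh | hh <;> rw [he] at h1 ⊢ <;> rw [hh] at h2 ⊢ <;>
        · push_cast at h1 h2
          exact absurd (by linarith) (h0 i)
    rw [this]
  · rintro ⟨i, hi⟩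
    -- These signs put `x` in a simplex; flipping the sign at `i` keeps it there, because `x` lies
    -- on the `i`-th hyperplane.
    let ε : Fin n → ℤˣ := fun k => if 0 ≤ inner ℝ (f k) x then -1 else 1
    have hε : ∀ k, ((ε k : ℤ) : ℝ) * inner ℝ (f k) x ≤ 0 := by
      intro k
      simp only [ε]
      split_ifs with h <;> push_cast <;> linarith
    refine ⟨_, ⟨ε, rfl⟩, _, ⟨Function.update ε i (-ε i), rfl⟩, ?_, mem_simplex_sign.mpr ⟨hx, hε⟩,
      mem_simplex_sign.mpr ⟨hx, fun k => ?_⟩⟩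
    -- The two simplices differ: the normalized `y` is interior to the first and violates the
    -- flipped inequality.
    · obtain ⟨y, hy⟩ := exists_inner_eq hli fun k => -((ε k : ℤ) : ℝ)
      have hsq : ∀ k, ((ε k : ℤ) : ℝ) * ((ε k : ℤ) : ℝ) = 1 := fun k => by
        rcases sign_cases (ε k) with h | h <;> rw [h] <;> norm_num
      have hy0 : y ≠ 0 := by
        rintro rfl
        have := hy i
        have h2 := hsq i
        rw [inner_zero_right] at this
        nlinarith
      have hpos : 0 < ‖y‖⁻¹ := inv_pos.mpr (norm_pos_iff.mpr hy0)
      intro heq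
      have hmem : ‖y‖⁻¹ • y ∈ simplex fun k => ((ε k : ℤ) : ℝ) • f k := by
        refine mem_simplex_sign.mpr ⟨by simp [norm_smul, hy0], fun k => ?_⟩
        rw [real_inner_smul_right, hy]
        have := hsq k
        nlinarith
      beta_reduce at heq
      rw [heq] at hmem
      have := (mem_simplex_sign.mp hmem).2 i
      rw [real_inner_smul_right, hy] at this
      simp only [Function.update_self] at this
      push_cast at this
      have h2 := hsq i
      nlinarith
    · rcases eq_or_ne k i with rfl | hk
      · rw [hi]; simp
      · rw [Function.update_of_ne hk]; exact hε k

/-- The vectors representing a family are unique up to order and scaling. -/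
theorem IsRepresentedBy.exists_perm {n : ℕ} {Φ : Set (Set (E n))} {f f' : Fin n → E n}
    (hf : IsRepresentedBy Φ f) (hf' : IsRepresentedBy Φ f') :
    ∃ (σ : Equiv.Perm (Fin n)) (c : Fin n → ℝ), (∀ i, c i ≠ 0) ∧ ∀ i, f' i = c i • f (σ i) := by
  have hzero : ∀ x : E n, (∃ i, inner ℝ (f i) x = 0) ↔ ∃ i, inner ℝ (f' i) x = 0 := by
    intro x
    rcases eq_or_ne x 0 with rfl | hx
    · simp
    · have h1 := hf.mem_two_iff (x := ‖x‖⁻¹ • x) (by simp [norm_smul, hx])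
      have h2 := hf'.mem_two_iff (x := ‖x‖⁻¹ • x) (by simp [norm_smul, hx])
      have := h1.symm.trans h2
      simpa [real_inner_smul_right, hx] using this
  have key : ∀ j, ∃ i, ∃ c : ℝ, c ≠ 0 ∧ f' j = c • f i := by
    intro j
    let V := (Submodule.span ℝ {f' j})ᗮ
    -- The hyperplane of `f' j` is covered by those of the finitely many `f i`, hence contained in
    -- one of them.
    obtain ⟨i, hi⟩ := Subspace.exists_eq_top_of_iUnion_eq_univ (k := ℝ) (E := V)
        (p := fun i => ((Submodule.span ℝ {f i})ᗮ).comap V.subtype) (by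
      rw [Set.eq_univ_iff_forall]
      rintro ⟨x, hx⟩
      have hx' : inner ℝ (f' j) x = 0 := Submodule.mem_orthogonal_singleton_iff_inner_right.mp hx
      obtain ⟨i, hi⟩ := (hzero x).mpr ⟨j, hx'⟩
      exact Set.mem_iUnion.mpr ⟨i, Submodule.mem_orthogonal_singleton_iff_inner_right.mpr hi⟩)
    have hle : V ≤ (Submodule.span ℝ {f i})ᗮ := by
      intro x hx
      have : (⟨x, hx⟩ : V) ∈ ((Submodule.span ℝ {f i})ᗮ).comap V.subtype := by rw [hi]; trivial
      exact this
    have hle' : Submodule.span ℝ {f i} ≤ Submodule.span ℝ {f' j} := by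
      have := Submodule.orthogonal_le hle
      simpa [V, Submodule.orthogonal_orthogonal] using this
    obtain ⟨c, hc⟩ := Submodule.mem_span_singleton.mp (hle' (Submodule.mem_span_singleton_self _))
    have hc0 : c ≠ 0 := by
      rintro rfl
      exact hf.1.ne_zero i (by rw [← hc, zero_smul])
    exact ⟨i, c⁻¹, inv_ne_zero hc0, by rw [← hc, smul_smul, inv_mul_cancel₀ hc0, one_smul]⟩
  choose σ c hc hσ using key
  have hinj : Function.Injective σ := by
    intro i j hij
    by_contra hne
    have h1 := hσ i
    have h2 := hσ j
    rw [hij] at h1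
    refine hne (hf'.1.eq_of_smul_apply_eq_smul_apply (c j) (c i) i j (hc j) ?_)
    rw [h1, h2, smul_smul, smul_smul, mul_comm]
  exact ⟨Equiv.ofBijective σ (Finite.injective_iff_bijective.mp hinj), c, hc, hσ⟩

theorem refl_mem_generatedGroup {n : ℕ} {Φ : Set (Set (E n))} {f : Fin n → E n}
    (hf : IsRepresentedBy Φ f) (i : Fin n) : refl (f i) ∈ generatedGroup Φ :=
  Subgroup.subset_closure ⟨f, hf, i, rfl⟩

theorem generatedGroup_eq {n : ℕ} {Φ : Set (Set (E n))} {f : Fin n → E n}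
    (hf : IsRepresentedBy Φ f) :
    generatedGroup Φ = Subgroup.closure (Set.range fun i => refl (f i)) := by
  refine congrArg Subgroup.closure (Set.ext fun s => ⟨?_, ?_⟩)
  · rintro ⟨f', hf', i, rfl⟩
    obtain ⟨σ, c, hc, h⟩ := hf.exists_perm hf'
    exact ⟨σ i, by rw [h i, refl_smul (hc i)]⟩
  · rintro ⟨i, rfl⟩
    exact ⟨f, hf, i, rfl⟩

/-! ### The standard basis -/

theorem inner_h_left {m : ℕ} (i : Fin m) (x : E m) : inner ℝ (h i) x = x i := by
  simp [h, EuclideanSpace.inner_single_left]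

theorem inner_h_right {m : ℕ} (i : Fin m) (x : E m) : inner ℝ x (h i) = x i := by
  rw [real_inner_comm, inner_h_left]

theorem h_apply {m : ℕ} (i k : Fin m) : (h i : E m) k = if k = i then 1 else 0 := by
  simp [h]

theorem linearIsometryEquiv_ext_h {m : ℕ} {u w : E m ≃ₗᵢ[ℝ] E m}
    (huw : ∀ k, u (h k) = w (h k)) : u = w := by
  have : u.toLinearEquiv.toLinearMap = w.toLinearEquiv.toLinearMap :=
    (EuclideanSpace.basisFun (Fin m) ℝ).toBasis.ext fun k => by simpa [h] using huw k
  ext1 x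
  exact LinearMap.congr_fun this x

/-- Two systems of vectors related by an isometry, up to order and signs, determine the same set
up to the isometry. -/
theorem setOf_pm_eq_image {ι : Type*} {m : ℕ} {r r' : ι → E m} (w : E m ≃ₗᵢ[ℝ] E m)
    (σ : Equiv.Perm ι) (hr : ∀ i, r' i = w (r (σ i)) ∨ r' i = -w (r (σ i))) :
    {x | ∃ i, x = r' i ∨ x = -r' i} = w '' {x | ∃ i, x = r i ∨ x = -r i} := by
  ext x
  constructor
  · rintro ⟨i, hx⟩
    have : x = w (r (σ i)) ∨ x = -w (r (σ i)) := by
      rcases hr i with h1 | h1 <;> rcases hx with rfl | rfl <;> simp [h1]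
    rcases this with rfl | rfl
    · exact ⟨_, ⟨σ i, Or.inl rfl⟩, rfl⟩
    · exact ⟨_, ⟨σ i, Or.inr rfl⟩, map_neg w _⟩
  · rintro ⟨y, ⟨i, hy⟩, rfl⟩
    refine ⟨σ.symm i, ?_⟩
    have := hr (σ.symm i)
    rw [Equiv.apply_symm_apply] at this
    rcases this with h1 | h1 <;> rcases hy with rfl | rfl <;> simp [h1]

/-- The permutation of coordinates. -/
noncomputable def permIso {m : ℕ} (π : Equiv.Perm (Fin m)) : E m ≃ₗᵢ[ℝ] E m :=
  LinearIsometryEquiv.piLpCongrLeft 2 ℝ ℝ π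

theorem permIso_h {m : ℕ} (π : Equiv.Perm (Fin m)) (i : Fin m) : permIso π (h i) = h (π i) :=
  EuclideanSpace.piLpCongrLeft_single π i 1

theorem norm_sq_h_sub {m : ℕ} {i j : Fin m} (hij : i ≠ j) : ‖h i - h j‖ ^ 2 = 2 := by
  rw [← real_inner_self_eq_norm_sq, inner_sub_left, inner_h_left, inner_h_left]
  simp [h_apply, hij, hij.symm]; norm_num

theorem refl_h_sub {m : ℕ} {i j : Fin m} (hij : i ≠ j) :
    refl (h i - h j) = permIso (Equiv.swap i j) := by
  refine linearIsometryEquiv_ext_h fun k => ?_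
  rw [permIso_h, refl_apply, norm_sq_h_sub hij, inner_sub_left, inner_h_left, inner_h_left,
    h_apply, h_apply, mul_div_cancel_left₀ _ two_ne_zero]
  rcases eq_or_ne k i with rfl | hi
  · simp [hij.symm]
  rcases eq_or_ne k j with rfl | hj
  · simp [hij]
  · simp [hi.symm, hj.symm, Equiv.swap_apply_of_ne_of_ne hi hj]

/-! ### The root system `Δ(Aₙ)` -/

theorem mem_rootsA {n : ℕ} {r : E (n + 1)} : r ∈ rootsA n ↔ ∃ i j, i ≠ j ∧ r = h i - h j := by
  constructor
  · rintro ⟨i, j, hij, rfl | rfl⟩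
    · exact ⟨i, j, hij.ne, rfl⟩
    · exact ⟨j, i, hij.ne', neg_sub _ _⟩
  · rintro ⟨i, j, hij, rfl⟩
    rcases hij.lt_or_gt with hlt | hlt
    · exact ⟨i, j, hlt, Or.inl rfl⟩
    · exact ⟨j, i, hlt, Or.inr (neg_sub _ _).symm⟩

theorem neg_mem_rootsA {n : ℕ} {r : E (n + 1)} (hr : r ∈ rootsA n) : -r ∈ rootsA n := by
  obtain ⟨i, j, hij, rfl⟩ := mem_rootsA.mp hr
  exact mem_rootsA.mpr ⟨j, i, hij.symm, neg_sub _ _⟩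

theorem norm_sq_of_mem_rootsA {n : ℕ} {r : E (n + 1)} (hr : r ∈ rootsA n) : ‖r‖ ^ 2 = 2 := by
  obtain ⟨i, j, hij, rfl⟩ := mem_rootsA.mp hr
  exact norm_sq_h_sub hij

theorem exists_perm_of_mem_weylGroupA {n : ℕ} {w : E (n + 1) ≃ₗᵢ[ℝ] E (n + 1)}
    (hw : w ∈ weylGroup (rootsA n)) : ∃ π, w = permIso π := by
  induction hw using Subgroup.closure_induction with
  | mem s hs =>
    obtain ⟨r, hr, rfl⟩ := hs
    obtain ⟨i, j, hij, rfl⟩ := mem_rootsA.mp hr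
    exact ⟨_, refl_h_sub hij⟩
  | one => exact ⟨1, linearIsometryEquiv_ext_h fun k => by rw [permIso_h]; rfl⟩
  | mul a b _ _ ha hb =>
    obtain ⟨π, rfl⟩ := ha
    obtain ⟨ρ, rfl⟩ := hb
    refine ⟨π * ρ, linearIsometryEquiv_ext_h fun k => ?_⟩
    change permIso π (permIso ρ (h k)) = _
    simp only [permIso_h, Equiv.Perm.mul_apply]
  | inv a _ ha =>
    obtain ⟨π, rfl⟩ := ha
    refine ⟨π⁻¹, linearIsometryEquiv_ext_h fun k => ?_⟩
    change (permIso π).symm (h k) = _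
    rw [LinearIsometryEquiv.symm_apply_eq, permIso_h, permIso_h]
    exact congrArg h (π.apply_symm_apply k).symm

theorem permIso_mem_of_refl_mem {m : ℕ} {G : Subgroup (E m ≃ₗᵢ[ℝ] E m)}
    (hG : ∀ i j : Fin m, i ≠ j → refl (h i - h j) ∈ G) (π : Equiv.Perm (Fin m)) :
    permIso π ∈ G := by
  induction π using Equiv.Perm.swap_induction_on with
  | one =>
    convert G.one_mem
    exact linearIsometryEquiv_ext_h fun k => by rw [permIso_h]; rfl
  | swap_mul f x y hxy hf =>
    have : permIso (Equiv.swap x y * f) = refl (h x - h y) * permIso f := by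
      rw [refl_h_sub hxy]
      refine linearIsometryEquiv_ext_h fun k => ?_
      change _ = permIso (Equiv.swap x y) (permIso f (h k))
      simp only [permIso_h, Equiv.Perm.mul_apply]
    rw [this]
    exact G.mul_mem (hG x y hxy) hf

theorem permIso_mem_weylGroupA {n : ℕ} (π : Equiv.Perm (Fin (n + 1))) :
    permIso π ∈ weylGroup (rootsA n) :=
  permIso_mem_of_refl_mem (fun i j hij => Subgroup.subset_closure
    (Set.mem_image_of_mem refl (mem_rootsA.mpr ⟨i, j, hij, rfl⟩))) π

theorem exists_apply_ne_zero {m : ℕ} {v : E m} (hv : v ≠ 0) : ∃ k, v k ≠ 0 := by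
  by_contra! hk
  refine hv ?_
  ext k
  exact hk k

/-- If `v k ≠ 0`, the reflection moves `h k` to another basis vector, and their difference is a
multiple of `v`. -/
theorem exists_smul_mem_rootsA {n : ℕ} {v : E (n + 1)} (hv : v ≠ 0)
    (hw : refl v ∈ weylGroup (rootsA n)) : ∃ c : ℝ, c ≠ 0 ∧ c • v ∈ rootsA n := by
  obtain ⟨π, hπ⟩ := exists_perm_of_mem_weylGroupA hw
  obtain ⟨k, hk⟩ := exists_apply_ne_zero hv
  have h1 : refl v (h k) = h (π k) := by rw [hπ, permIso_h]
  obtain ⟨c, hc, hcv⟩ := exists_smul_eq_sub_of_refl_eq h1 (by rwa [inner_h_right])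
  refine ⟨c, hc, mem_rootsA.mpr ⟨k, π k, ?_, hcv⟩⟩
  intro hne
  rw [← hne, sub_self, smul_eq_zero] at hcv
  exact hcv.elim hc hv

/-! ### The hyperplane of coordinate sum zero -/

/-- The vector all of whose coordinates are `1`. -/
noncomputable def ones (m : ℕ) : E m := WithLp.toLp 2 fun _ => 1

theorem ones_apply {m : ℕ} (k : Fin m) : ones m k = 1 := rfl

theorem inner_ones_left {m : ℕ} (x : E m) : inner ℝ (ones m) x = ∑ k, x k := by
  simp [PiLp.inner_apply, ones_apply]

theorem permIso_apply {m : ℕ} (π : Equiv.Perm (Fin m)) (x : E m) (k : Fin m) :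
    permIso π x (π k) = x k := by
  rw [← inner_h_left, ← permIso_h, LinearIsometryEquiv.inner_map_map, inner_h_left]

theorem permIso_ones {m : ℕ} (π : Equiv.Perm (Fin m)) : permIso π (ones m) = ones m := by
  ext k
  obtain ⟨j, rfl⟩ := π.surjective k
  rw [permIso_apply, ones_apply, ones_apply]

theorem inner_ones_of_mem_rootsA {n : ℕ} {r : E (n + 1)} (hr : r ∈ rootsA n) :
    inner ℝ (ones (n + 1)) r = 0 := by
  obtain ⟨i, j, _, rfl⟩ := mem_rootsA.mp hr
  rw [inner_sub_right, inner_h_right, inner_h_right, ones_apply, ones_apply, sub_self]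

theorem ones_ne_zero (n : ℕ) : ones (n + 1) ≠ 0 := by
  intro h0
  have := congrArg (fun x : E (n + 1) => x 0) h0
  simp [ones_apply] at this

theorem inner_ones_map {n m : ℕ} (φ : E n →ₗᵢ[ℝ] E m) {f : Fin n → E n}
    (hf : LinearIndependent ℝ f) (h0 : ∀ k, inner ℝ (ones m) (φ (f k)) = 0) (y : E n) :
    inner ℝ (ones m) (φ y) = 0 := by
  have hy : y ∈ Submodule.span ℝ (Set.range f) := by rw [span_range_eq_top hf]; trivial
  induction hy using Submodule.span_induction with
  | mem x hx => obtain ⟨k, rfl⟩ := hx; exact h0 k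
  | zero => simp
  | add a b _ _ ha hb => rw [map_add, inner_add_right, ha, hb, add_zero]
  | smul c a _ ha => rw [map_smul, real_inner_smul_right, ha, mul_zero]

/-- An isometric embedding of `𝔼ⁿ` into the hyperplane of vectors with coordinate sum zero
is onto this hyperplane. -/
theorem exists_eq_of_inner_ones {n : ℕ} (φ : E n →ₗᵢ[ℝ] E (n + 1))
    (hφ : ∀ y, inner ℝ (ones (n + 1)) (φ y) = 0) {x : E (n + 1)}
    (hx : inner ℝ (ones (n + 1)) x = 0) : ∃ y, φ y = x := by
  have hle : LinearMap.range φ.toLinearMap ≤ (Submodule.span ℝ {ones (n + 1)})ᗮ := by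
    rintro _ ⟨y, rfl⟩
    exact Submodule.mem_orthogonal_singleton_iff_inner_right.mpr (hφ y)
  have : Fact (Module.finrank ℝ (E (n + 1)) = n + 1) := ⟨by simp⟩
  have heq := Submodule.eq_of_le_of_finrank_eq hle (by
    rw [Submodule.finrank_orthogonal_span_singleton (n := n) (ones_ne_zero n),
      LinearMap.finrank_range_of_inj φ.injective]
    simp)
  have : x ∈ LinearMap.range φ.toLinearMap := by
    rw [heq]; exact Submodule.mem_orthogonal_singleton_iff_inner_right.mpr hx
  exact this

/-- Both isometries fix `ones`, and they agree on its orthogonal complement, which is the image of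
`φ`. -/
theorem refl_map_eq_of_intertwining {n : ℕ} (φ : E n →ₗᵢ[ℝ] E (n + 1))
    (hφ : ∀ y, inner ℝ (ones (n + 1)) (φ y) = 0) {v : E n} {w : E (n + 1) ≃ₗᵢ[ℝ] E (n + 1)}
    (hw : ∀ x, φ (refl v x) = w (φ x)) (hw1 : w (ones (n + 1)) = ones (n + 1)) :
    refl (φ v) = w := by
  ext1 x
  let t : ℝ := inner ℝ (ones (n + 1)) x / ‖ones (n + 1)‖ ^ 2
  have hn := norm_ne_zero_iff.mpr (ones_ne_zero n)
  obtain ⟨y, hy⟩ := exists_eq_of_inner_ones φ hφ (x := x - t • ones (n + 1)) (by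
    rw [inner_sub_right, real_inner_smul_right, real_inner_self_eq_norm_sq]
    simp only [t]
    field_simp
    ring)
  have hxy : x = φ y + t • ones (n + 1) := by rw [hy]; abel
  have h1 : refl (φ v) (ones (n + 1)) = ones (n + 1) := by
    rw [refl_apply, real_inner_comm, hφ]; simp
  rw [hxy, map_add, map_add, map_smul, map_smul, h1, hw1, ← map_refl, hw]

/-! ### Existence in type `Aₙ` -/

/-- The unit normals of a Coxeter simplex of type `Aₙ` can be identified with normalized roots. -/
theorem exists_embedding_coxeterA {n : ℕ} {e : Fin n → E n}
    (he : IsCoxeterSimplex (CoxeterMatrix.A n) e) :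
    ∃ φ : E n →ₗᵢ[ℝ] E (n + 1), ∀ i, Real.sqrt 2 • φ (e i) ∈ rootsA n := by
  have hs : Real.sqrt 2 * Real.sqrt 2 = 2 := Real.mul_self_sqrt zero_le_two
  have hs0 : Real.sqrt 2 ≠ 0 := by positivity
  obtain ⟨φ, hφ⟩ := exists_linearIsometry_of_gram he.1
    (fun i : Fin n => (Real.sqrt 2)⁻¹ • ((h i.castSucc : E (n + 1)) - h i.succ)) (by
    intro i j
    rw [he.2, real_inner_smul_left, real_inner_smul_right, inner_sub_left, inner_h_left,
      inner_h_left, ← mul_assoc, ← mul_inv, hs]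
    simp only [PiLp.sub_apply, h_apply, CoxeterMatrix.A, Matrix.of_apply, Fin.ext_iff,
      Fin.val_castSucc, Fin.val_succ]
    by_cases h1 : (i : ℕ) = j
    · simp [h1]; norm_num
    · by_cases h2 : (j : ℕ) + 1 = i
      · simp [h2.symm, show ¬(j : ℕ) + 1 + 1 = j by omega]
      · by_cases h3 : (i : ℕ) + 1 = j
        · simp [h3.symm, show (i : ℕ) ≠ i + 1 + 1 by omega]
        · simp [h1, h2, h3, Ne.symm h2])
  refine ⟨φ, fun i => mem_rootsA.mpr ⟨i.castSucc, i.succ, (Fin.castSucc_lt_succ).ne, ?_⟩⟩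
  rw [hφ, smul_smul, mul_inv_cancel₀ hs0, one_smul]

theorem exists_isEmbedding_A {n : ℕ} {Φ : Set (Set (E n))} (hΦ : IsFamily Φ)
    (hgen : Generates Φ (CoxeterMatrix.A n)) : ∃ R, IsEmbedding Φ (rootsA n) R := by
  obtain ⟨f, hf⟩ := hΦ
  obtain ⟨e, he, hG⟩ := hgen
  obtain ⟨φ, hφ⟩ := exists_embedding_coxeterA he
  have hs0 : Real.sqrt 2 ≠ 0 := by positivity
  have hφ1 := inner_ones_map φ he.1 fun k => by
    have := inner_ones_of_mem_rootsA (hφ k)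
    rw [real_inner_smul_right] at this
    exact (mul_eq_zero.mp this).resolve_left hs0
  have key : ∀ i, ∃ c : ℝ, c ≠ 0 ∧ c • φ (f i) ∈ rootsA n := by
    intro i
    have hmem := refl_mem_generatedGroup hf i
    rw [hG] at hmem
    obtain ⟨w, hw, hw'⟩ := exists_weylGroup_intertwining φ (Δ := rootsA n) (by
      rintro _ ⟨j, rfl⟩
      exact ⟨Real.sqrt 2 • e j, (refl_smul hs0 _).symm, by rw [map_smul]; exact hφ j⟩) hmem
    have hw1 : w (ones (n + 1)) = ones (n + 1) := by
      obtain ⟨π, rfl⟩ := exists_perm_of_mem_weylGroupA hw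
      exact permIso_ones π
    rw [← refl_map_eq_of_intertwining φ hφ1 hw' hw1] at hw
    exact exists_smul_mem_rootsA ((map_ne_zero_iff φ φ.injective).mpr (hf.1.ne_zero i)) hw
  choose c hc hr using key
  refine ⟨_, ?_, φ, fun i => c i • f i, hf.smul hc, rfl⟩
  rintro _ ⟨i, rfl | rfl⟩
  · rw [map_smul]; exact hr i
  · rw [map_smul]; exact neg_mem_rootsA (hr i)

/-! ### Uniqueness in type `Aₙ` -/

/-- The lattice of vectors with integer coordinates. -/
def intLattice (m : ℕ) : AddSubgroup (E m) where
  carrier := {x | ∀ k, ∃ z : ℤ, x k = z}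
  zero_mem' := fun k => ⟨0, by simp⟩
  add_mem' := by
    intro x y hx hy k
    obtain ⟨a, ha⟩ := hx k
    obtain ⟨b, hb⟩ := hy k
    exact ⟨a + b, by simp [ha, hb]⟩
  neg_mem' := by
    intro x hx k
    obtain ⟨a, ha⟩ := hx k
    exact ⟨-a, by simp [ha]⟩

theorem h_mem_intLattice {m : ℕ} (i : Fin m) : h i ∈ intLattice m := fun k =>
  ⟨if k = i then 1 else 0, by rw [h_apply]; split_ifs <;> simp⟩

/-- Some coordinate `x a` is at least 1 and some `x b` at most -1, so `‖x - (h a - h b)‖ ^ 2 = 4 - 2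
* (x a - x b) ≤ 0`. -/
theorem mem_rootsA_of_intLattice {n : ℕ} {x : E (n + 1)} (hx : x ∈ intLattice (n + 1))
    (h1 : inner ℝ (ones (n + 1)) x = 0) (h2 : ‖x‖ ^ 2 = 2) : x ∈ rootsA n := by
  rw [inner_ones_left] at h1
  have hx0 : x ≠ 0 := by rintro rfl; simp at h2
  obtain ⟨k, hk⟩ := exists_apply_ne_zero hx0
  obtain ⟨a, -, ha⟩ := Finset.exists_pos_of_sum_zero_of_exists_nonzero (fun i => x i) h1
    ⟨k, Finset.mem_univ _, hk⟩
  obtain ⟨b, -, hb⟩ := Finset.exists_pos_of_sum_zero_of_exists_nonzero (fun i => -x i)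
    (by rw [Finset.sum_neg_distrib, h1, neg_zero]) ⟨k, Finset.mem_univ _, neg_ne_zero.mpr hk⟩
  have hab : a ≠ b := by rintro rfl; linarith
  obtain ⟨p, hp⟩ := hx a
  obtain ⟨q, hq⟩ := hx b
  have hp1 : (1 : ℝ) ≤ x a := by
    rw [hp] at ha ⊢
    exact_mod_cast ha
  have hq1 : x b ≤ -1 := by
    rw [hq] at hb ⊢
    have : q < 0 := by exact_mod_cast neg_pos.mp hb
    have h3 : q ≤ -1 := by omega
    calc (q : ℝ) ≤ ((-1 : ℤ) : ℝ) := Int.cast_le.mpr h3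
      _ = -1 := by norm_num
  refine mem_rootsA.mpr ⟨a, b, hab, ?_⟩
  have := norm_sub_sq_real x (h a - h b)
  rw [norm_sq_h_sub hab, h2, inner_sub_right, inner_h_right, inner_h_right] at this
  have h0 : ‖x - (h a - h b)‖ = 0 := by
    have := sq_nonneg ‖x - (h a - h b)‖
    exact pow_eq_zero_iff two_ne_zero |>.mp (by linarith)
  exact sub_eq_zero.mp (norm_eq_zero.mp h0)

/-- Any `n` linearly independent roots of type `Aₙ` generate the root lattice. -/
theorem exists_int_combination_A {n : ℕ} (φ : E n →ₗᵢ[ℝ] E (n + 1)) {f : Fin n → E n}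
    (hf : LinearIndependent ℝ f) (hr : ∀ k, φ (f k) ∈ rootsA n) (j : Fin (n + 1)) :
    ∃ y ∈ AddSubgroup.closure (Set.range f), φ y = h 0 - h j := by
  classical
  let L := (AddSubgroup.closure (Set.range f)).map φ.toLinearMap.toAddMonoidHom
  have hrL : ∀ k, φ (f k) ∈ L := fun k =>
    ⟨f k, AddSubgroup.subset_closure ⟨k, rfl⟩, rfl⟩
  -- `χ` is the indicator of the connected component of `0` in the graph whose edges are the roots.
  -- It is orthogonal to every root used, hence to the whole sum-zero hyperplane, hence constant.
  let χ : E (n + 1) := WithLp.toLp 2 fun j => if h 0 - h j ∈ L then 1 else 0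
  have hχ : ∀ j, χ j = if h 0 - h j ∈ L then 1 else 0 := fun j => rfl
  have horth : ∀ y, inner ℝ χ (φ y) = 0 := by
    intro y
    have hy : y ∈ Submodule.span ℝ (Set.range f) := by rw [span_range_eq_top hf]; trivial
    induction hy using Submodule.span_induction with
    | mem x hx =>
      obtain ⟨k, rfl⟩ := hx
      have hk := hrL k
      obtain ⟨a, b, -, hab⟩ := mem_rootsA.mp (hr k)
      rw [hab] at hk ⊢
      have hiff : h 0 - h a ∈ L ↔ h 0 - h b ∈ L := by
        rw [show (h 0 - h b : E (n + 1)) = (h 0 - h a) + (h a - h b) by abel]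
        exact (L.add_mem_cancel_right hk).symm
      rw [inner_sub_right, inner_h_right, inner_h_right, hχ, hχ]
      simp only [hiff, sub_self]
    | zero => simp
    | add a b _ _ ha hb => rw [map_add, inner_add_right, ha, hb, add_zero]
    | smul c a _ ha => rw [map_smul, real_inner_smul_right, ha, mul_zero]
  obtain ⟨y, hy⟩ := exists_eq_of_inner_ones φ
    (inner_ones_map φ hf fun k => inner_ones_of_mem_rootsA (hr k)) (x := h 0 - h j)
    (by rw [inner_sub_right, inner_h_right, inner_h_right, ones_apply, ones_apply, sub_self])
  have h1 := horth y
  rw [hy, inner_sub_right, inner_h_right, inner_h_right, hχ, hχ, sub_self,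
    if_pos L.zero_mem] at h1
  have : h 0 - h j ∈ L := by
    by_contra hL
    rw [if_neg hL] at h1
    norm_num at h1
  exact this

/-- Two embeddings of the same basis into `Δ(Aₙ)` differ by an element of the Weyl group and
a sign. -/
theorem exists_weylGroup_of_mem_rootsA {n : ℕ} (φ φ' : E n →ₗᵢ[ℝ] E (n + 1)) {f : Fin n → E n}
    (hf : LinearIndependent ℝ f) (hr : ∀ k, φ (f k) ∈ rootsA n)
    (hr' : ∀ k, φ' (f k) ∈ rootsA n) :
    ∃ w ∈ weylGroup (rootsA n),
      (∀ k, φ' (f k) = w (φ (f k))) ∨ ∀ k, φ' (f k) = -w (φ (f k)) := by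
  choose y hyL hy using exists_int_combination_A φ hf hr
  have hlat : ∀ x ∈ AddSubgroup.closure (Set.range f), φ' x ∈ intLattice (n + 1) := by
    intro x hx
    induction hx using AddSubgroup.closure_induction with
    | mem x hx =>
      obtain ⟨k, rfl⟩ := hx
      obtain ⟨i, j, -, hij⟩ := mem_rootsA.mp (hr' k)
      rw [hij]
      exact sub_mem (h_mem_intLattice i) (h_mem_intLattice j)
    | zero => rw [map_zero]; exact zero_mem _
    | add a b _ _ ha hb => rw [map_add]; exact add_mem ha hb
    | neg a _ ha => rw [map_neg]; exact neg_mem ha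
  have hinner : ∀ i j, inner ℝ (φ' (y i)) (φ' (y j)) = inner ℝ (h 0 - h i : E (n + 1)) (h 0 - h j) :=
    fun i j => by rw [φ'.inner_map_map, ← φ.inner_map_map, hy, hy]
  have hy0 : φ' (y 0) = 0 := by
    have := hy 0
    rw [sub_self] at this
    rw [(map_eq_zero_iff φ φ.injective).mp this, map_zero]
  have hroot : ∀ i, i ≠ 0 → φ' (y i) ∈ rootsA n := by
    intro i hi
    refine mem_rootsA_of_intLattice (hlat _ (hyL i))
      (inner_ones_map φ' hf (fun k => inner_ones_of_mem_rootsA (hr' k)) _) ?_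
    rw [← real_inner_self_eq_norm_sq, hinner, real_inner_self_eq_norm_sq,
      norm_sq_h_sub (Ne.symm hi)]
  -- The index `0` carries no root, since `φ' (y 0) = 0`; its values of `a` and `b` are arbitrary.
  have hab : ∀ i, ∃ a b, i ≠ 0 → a ≠ b ∧ φ' (y i) = h a - h b := by
    intro i
    by_cases hi : i = 0
    · exact ⟨0, 0, fun h => absurd hi h⟩
    · obtain ⟨a, b, hab⟩ := mem_rootsA.mp (hroot i hi)
      exact ⟨a, b, fun _ => hab⟩
  choose a b hab using hab
  -- The inner product is 1. Two agreements would give 2, and none at most 0.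
  have hone : ∀ i j, i ≠ 0 → j ≠ 0 → i ≠ j →
      (a i = a j ∧ b i ≠ b j) ∨ (a i ≠ a j ∧ b i = b j) := by
    intro i j hi hj hij
    have h1 := hinner i j
    rw [(hab i hi).2, (hab j hj).2] at h1
    have hai := (hab i hi).1
    have haj := (hab j hj).1
    simp only [inner_sub_left, inner_h_left, PiLp.sub_apply, h_apply, hi, hij, hj.symm,
      if_true, if_false] at h1
    by_cases c1 : a i = a j <;> by_cases c2 : b i = b j
    · simp [c1, c2, haj, haj.symm] at h1
    · exact Or.inl ⟨c1, c2⟩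
    · exact Or.inr ⟨c1, c2⟩
    · rw [if_neg c1, if_neg c2] at h1
      split_ifs at h1 <;> norm_num at h1
  have hperm : ∀ (p : Fin (n + 1)) (q : Fin (n + 1) → Fin (n + 1)),
      (∀ i, i ≠ 0 → q i ≠ p) → (∀ i j, i ≠ 0 → j ≠ 0 → i ≠ j → q i ≠ q j) →
      ∃ π : Equiv.Perm (Fin (n + 1)), π 0 = p ∧ ∀ i, i ≠ 0 → π i = q i := by
    intro p q h1 h2
    have hinj : Function.Injective fun i => if i = 0 then p else q i := by
      intro i j hij
      by_contra hne
      by_cases hi : i = 0 <;> by_cases hj : j = 0 <;> simp only [hi, hj, if_true, if_false] at hij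
      · exact hne (hi.trans hj.symm)
      · exact h1 j hj hij.symm
      · exact h1 i hi hij
      · exact h2 i j hi hj hne hij
    refine ⟨Equiv.ofBijective _ (Finite.injective_iff_bijective.mp hinj), ?_, fun i hi => ?_⟩
    · simp
    · simp [hi]
  have hfk : ∀ k, ∃ i j, φ (f k) = h i - h j ∧ φ' (f k) = φ' (y j) - φ' (y i) := by
    intro k
    obtain ⟨i, j, -, hij⟩ := mem_rootsA.mp (hr k)
    refine ⟨i, j, hij, ?_⟩
    rw [← map_sub]
    congr 1
    apply φ.injective
    rw [map_sub, hij, hy, hy]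
    abel
  -- A common positive index gives a permutation; otherwise the negative index is common, giving
  -- minus a permutation.
  by_cases hcase : ∀ i j, i ≠ 0 → j ≠ 0 → a i = a j
  · obtain ⟨p, hp⟩ : ∃ p, ∀ i, i ≠ 0 → a i = p := by
      by_cases hex : ∃ i : Fin (n + 1), i ≠ 0
      · obtain ⟨i, hi⟩ := hex
        exact ⟨a i, fun j hj => hcase j i hj hi⟩
      · exact ⟨0, fun i hi => absurd ⟨i, hi⟩ hex⟩
    obtain ⟨π, hπ0, hπ⟩ := hperm p b (fun i hi => by rw [← hp i hi]; exact (hab i hi).1.symm)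
      (fun i j hi hj hij => ((hone i j hi hj hij).resolve_right
        fun hh => hh.1 (hcase i j hi hj)).2)
    have hz : ∀ i, φ' (y i) = h (π 0) - h (π i) := by
      intro i
      by_cases hi : i = 0
      · rw [hi, hy0, sub_self]
      · rw [(hab i hi).2, hπ0, hπ i hi, hp i hi]
    refine ⟨permIso π, permIso_mem_weylGroupA π, Or.inl fun k => ?_⟩
    obtain ⟨i, j, h1, h2⟩ := hfk k
    rw [h1, h2, hz, hz, map_sub, permIso_h, permIso_h]
    abel
  · push Not at hcase
    obtain ⟨i₀, j₀, hi₀, hj₀, hne⟩ := hcase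
    have hij : i₀ ≠ j₀ := fun hh => hne (by rw [hh])
    have hb₀ : b i₀ = b j₀ := ((hone i₀ j₀ hi₀ hj₀ hij).resolve_left fun hh => hne hh.1).2
    -- A `k` with another negative index would share its positive index with both `i₀` and `j₀`,
    -- although theirs differ.
    have hb : ∀ k, k ≠ 0 → b k = b i₀ := by
      intro k hk
      by_contra hbk
      have hk1 : k ≠ i₀ := fun hh => hbk (by rw [hh])
      have hk2 : k ≠ j₀ := fun hh => hbk (by rw [hh, hb₀])
      have e1 := ((hone k i₀ hk hi₀ hk1).resolve_right fun hh => hbk hh.2).1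
      have e2 := ((hone k j₀ hk hj₀ hk2).resolve_right fun hh => hbk (hh.2.trans hb₀.symm)).1
      exact hne (e1.symm.trans e2)
    obtain ⟨π, hπ0, hπ⟩ := hperm (b i₀) a (fun i hi => by rw [← hb i hi]; exact (hab i hi).1)
      (fun i j hi hj hij => ((hone i j hi hj hij).resolve_left
        fun hh => hh.2 ((hb i hi).trans (hb j hj).symm)).1)
    have hz : ∀ i, φ' (y i) = -(h (π 0) - h (π i)) := by
      intro i
      by_cases hi : i = 0
      · rw [hi, hy0, sub_self, neg_zero]
      · rw [(hab i hi).2, hπ0, hπ i hi, hb i hi, neg_sub]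
    refine ⟨permIso π, permIso_mem_weylGroupA π, Or.inr fun k => ?_⟩
    obtain ⟨i, j, h1, h2⟩ := hfk k
    rw [h1, h2, hz, hz, map_sub, permIso_h, permIso_h]
    abel

theorem hasUniqueEmbedding_A {n : ℕ} {Φ : Set (Set (E n))} (hΦ : IsFamily Φ)
    (hgen : Generates Φ (CoxeterMatrix.A n)) : HasUniqueEmbedding Φ (rootsA n) := by
  obtain ⟨R, hR⟩ := exists_isEmbedding_A hΦ hgen
  refine ⟨R, hR, ?_⟩
  obtain ⟨hRΔ, φ, f, hf, rfl⟩ := hR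
  rintro R' ⟨hRΔ', φ', f', hf', rfl⟩
  obtain ⟨σ, c, -, hcf⟩ := hf.exists_perm hf'
  have hr : ∀ i, φ (f i) ∈ rootsA n := fun i => hRΔ ⟨i, Or.inl rfl⟩
  have hr' : ∀ i, φ' (f' i) ∈ rootsA n := fun i => hRΔ' ⟨i, Or.inl rfl⟩
  have hc : ∀ i, c i = 1 ∨ c i = -1 := by
    intro i
    have h1 := norm_sq_of_mem_rootsA (hr (σ i))
    have h2 := norm_sq_of_mem_rootsA (hr' i)
    rw [hcf, φ'.norm_map, norm_smul, mul_pow, Real.norm_eq_abs, sq_abs] at h2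
    rw [φ.norm_map] at h1
    rw [h1] at h2
    exact sq_eq_one_iff.mp (by linarith)
  have hpm : ∀ i, φ' (f' i) = φ' (f (σ i)) ∨ φ' (f' i) = -φ' (f (σ i)) := by
    intro i
    rw [hcf]
    rcases hc i with h1 | h1 <;> simp [h1]
  have hr'' : ∀ k, φ' (f k) ∈ rootsA n := by
    intro k
    have h1 := hr' (σ.symm k)
    have h2 := hpm (σ.symm k)
    rw [Equiv.apply_symm_apply] at h2
    rcases h2 with h2 | h2
    · rwa [h2] at h1
    · rw [h2] at h1
      simpa using neg_mem_rootsA h1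
  obtain ⟨w, hw, hwf⟩ := exists_weylGroup_of_mem_rootsA φ φ' hf.1 hr hr''
  refine ⟨w, hw, setOf_pm_eq_image (r := fun i => φ (f i)) (r' := fun i => φ' (f' i)) w σ
    fun i => ?_⟩
  rcases hwf with hwf | hwf <;> rcases hpm i with h1 | h1 <;> simp [h1, hwf]

/-! ### The root system `Δ(Bₙ)` -/

/-- The short roots of `Δ(Bₙ)`. -/
def shortB (n : ℕ) : Set (E n) :=
  {r | ∃ (i : Fin n) (s : ℝ), (s = 1 ∨ s = -1) ∧ r = s • h i}

/-- The long roots of `Δ(Bₙ)`. -/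
def longB (n : ℕ) : Set (E n) :=
  {r | ∃ (i j : Fin n) (s t : ℝ), i ≠ j ∧ (s = 1 ∨ s = -1) ∧ (t = 1 ∨ t = -1) ∧
    r = s • h i + t • h j}

theorem mem_rootsB {n : ℕ} {r : E n} : r ∈ rootsB n ↔ r ∈ shortB n ∨ r ∈ longB n := by
  constructor
  · rintro (⟨i, rfl | rfl⟩ | ⟨i, j, hij, rfl | rfl | rfl | rfl⟩)
    · exact Or.inl ⟨i, 1, Or.inl rfl, by simp⟩
    · exact Or.inl ⟨i, -1, Or.inr rfl, by simp⟩
    · exact Or.inr ⟨i, j, 1, 1, hij.ne, Or.inl rfl, Or.inl rfl, by simp⟩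
    · exact Or.inr ⟨i, j, 1, -1, hij.ne, Or.inl rfl, Or.inr rfl, by simp [sub_eq_add_neg]⟩
    · exact Or.inr ⟨i, j, -1, 1, hij.ne, Or.inr rfl, Or.inl rfl, by simp⟩
    · exact Or.inr ⟨i, j, -1, -1, hij.ne, Or.inr rfl, Or.inr rfl, by simp [sub_eq_add_neg]⟩
  · have aux : ∀ (i j : Fin n) (s t : ℝ), i < j → (s = 1 ∨ s = -1) → (t = 1 ∨ t = -1) →
        s • h i + t • h j ∈ rootsB n := by
      intro i j s t hij hs ht
      refine Or.inr ⟨i, j, hij, ?_⟩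
      rcases hs with rfl | rfl <;> rcases ht with rfl | rfl <;> simp [sub_eq_add_neg]
    rintro (⟨i, s, rfl | rfl, rfl⟩ | ⟨i, j, s, t, hij, hs, ht, rfl⟩)
    · exact Or.inl ⟨i, Or.inl (by simp)⟩
    · exact Or.inl ⟨i, Or.inr (by simp)⟩
    · rcases hij.lt_or_gt with hlt | hlt
      · exact aux i j s t hlt hs ht
      · rw [add_comm]; exact aux j i t s hlt ht hs

theorem sign_mul_self {s : ℝ} (hs : s = 1 ∨ s = -1) : s * s = 1 := by
  rcases hs with rfl | rfl <;> norm_num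

theorem neg_sign {s : ℝ} (hs : s = 1 ∨ s = -1) : -s = 1 ∨ -s = -1 := by
  rcases hs with rfl | rfl <;> simp

theorem neg_mem_rootsB {n : ℕ} {r : E n} (hr : r ∈ rootsB n) : -r ∈ rootsB n := by
  rw [mem_rootsB] at hr ⊢
  rcases hr with ⟨i, s, hs, rfl⟩ | ⟨i, j, s, t, hij, hs, ht, rfl⟩
  · exact Or.inl ⟨i, -s, neg_sign hs, by rw [neg_smul]⟩
  · exact Or.inr ⟨i, j, -s, -t, hij, neg_sign hs, neg_sign ht, by simp [add_comm]⟩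

theorem norm_sq_of_mem_shortB {n : ℕ} {r : E n} (hr : r ∈ shortB n) : ‖r‖ ^ 2 = 1 := by
  obtain ⟨i, s, hs, rfl⟩ := hr
  rw [← real_inner_self_eq_norm_sq, real_inner_smul_left, real_inner_smul_right, inner_h_left,
    h_apply, if_pos rfl, mul_one, sign_mul_self hs]

theorem norm_sq_of_mem_longB {n : ℕ} {r : E n} (hr : r ∈ longB n) : ‖r‖ ^ 2 = 2 := by
  obtain ⟨i, j, s, t, hij, hs, ht, rfl⟩ := hr
  rw [← real_inner_self_eq_norm_sq]
  simp only [inner_add_left, inner_add_right, real_inner_smul_left, real_inner_smul_right,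
    inner_h_left, h_apply, if_true, if_neg hij, if_neg hij.symm]
  have := sign_mul_self hs
  have := sign_mul_self ht
  linarith

theorem refl_short_h {n : ℕ} (i k : Fin n) :
    refl (h i) (h k) = if k = i then -h k else h k := by
  have h1 : ‖(h i : E n)‖ ^ 2 = 1 := norm_sq_of_mem_shortB ⟨i, 1, Or.inl rfl, (one_smul _ _).symm⟩
  rw [refl_apply, h1, inner_h_left, h_apply, div_one]
  rcases eq_or_ne k i with rfl | hk
  · rw [if_pos rfl, if_pos rfl, mul_one, two_smul]
    abel
  · rw [if_neg hk, if_neg hk.symm]; simp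

theorem refl_long_apply {n : ℕ} {i j : Fin n} {s t : ℝ} (hij : i ≠ j) (hs : s = 1 ∨ s = -1)
    (ht : t = 1 ∨ t = -1) (x : E n) :
    refl (s • h i + t • h j) x = x - (s * x i + t * x j) • (s • h i + t • h j) := by
  rw [refl_apply, norm_sq_of_mem_longB ⟨i, j, s, t, hij, hs, ht, rfl⟩,
    mul_div_cancel_left₀ _ two_ne_zero, inner_add_left, real_inner_smul_left,
    real_inner_smul_left, inner_h_left, inner_h_left]

/-- The isometries permuting the coordinate axes. -/
def IsSignedPerm {n : ℕ} (w : E n ≃ₗᵢ[ℝ] E n) : Prop :=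
  ∀ k, ∃ (j : Fin n) (s : ℝ), (s = 1 ∨ s = -1) ∧ w (h k) = s • h j

theorem isSignedPerm_refl {n : ℕ} {r : E n} (hr : r ∈ rootsB n) : IsSignedPerm (refl r) := by
  intro k
  rcases mem_rootsB.mp hr with ⟨i, s, hs, rfl⟩ | ⟨i, j, s, t, hij, hs, ht, rfl⟩
  · rw [refl_smul (by rintro rfl; norm_num at hs), refl_short_h]
    split_ifs
    · exact ⟨k, -1, Or.inr rfl, by simp⟩
    · exact ⟨k, 1, Or.inl rfl, by simp⟩
  · have hst : -(s * t) = 1 ∨ -(s * t) = -1 := by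
      rcases hs with rfl | rfl <;> rcases ht with rfl | rfl <;> norm_num
    have hss := sign_mul_self hs
    have htt := sign_mul_self ht
    rw [refl_long_apply hij hs ht]
    rcases eq_or_ne k i with rfl | hki
    · refine ⟨j, -(s * t), hst, ?_⟩
      rw [h_apply, h_apply, if_pos rfl, if_neg hij.symm, mul_one, mul_zero, add_zero, smul_add,
        smul_smul, smul_smul, hss, one_smul, neg_smul]
      abel
    rcases eq_or_ne k j with rfl | hkj
    · refine ⟨i, -(s * t), hst, ?_⟩
      rw [h_apply, h_apply, if_pos rfl, if_neg hij, mul_one, mul_zero, zero_add, smul_add,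
        smul_smul, smul_smul, htt, one_smul, neg_smul, mul_comm t s]
      abel
    · refine ⟨k, 1, Or.inl rfl, ?_⟩
      rw [h_apply, h_apply, if_neg hki.symm, if_neg hkj.symm]
      simp

theorem IsSignedPerm.mul {n : ℕ} {u w : E n ≃ₗᵢ[ℝ] E n} (hu : IsSignedPerm u)
    (hw : IsSignedPerm w) : IsSignedPerm (u * w) := by
  intro k
  obtain ⟨j, s, hs, hj⟩ := hw k
  obtain ⟨l, t, ht, hl⟩ := hu j
  refine ⟨l, s * t, ?_, ?_⟩
  · rcases hs with rfl | rfl <;> rcases ht with rfl | rfl <;> norm_num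
  · change u (w (h k)) = _
    rw [hj, map_smul, hl, smul_smul]

theorem refl_inv {m : ℕ} (v : E m) : (refl v)⁻¹ = refl v :=
  Submodule.reflection_symm

theorem isSignedPerm_of_mem_weylGroupB {n : ℕ} {w : E n ≃ₗᵢ[ℝ] E n}
    (hw : w ∈ weylGroup (rootsB n)) : IsSignedPerm w := by
  -- Carrying the inverse along makes the `inv` case a swap; the generators are involutions.
  suffices IsSignedPerm w ∧ IsSignedPerm w⁻¹ from this.1
  induction hw using Subgroup.closure_induction with
  | mem s hs =>
    obtain ⟨r, hr, rfl⟩ := hs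
    rw [refl_inv]
    exact ⟨isSignedPerm_refl hr, isSignedPerm_refl hr⟩
  | one =>
    rw [inv_one]
    have : IsSignedPerm (1 : E n ≃ₗᵢ[ℝ] E n) := fun k => ⟨k, 1, Or.inl rfl, (one_smul _ _).symm⟩
    exact ⟨this, this⟩
  | mul a b _ _ ha hb => rw [mul_inv_rev]; exact ⟨ha.1.mul hb.1, hb.2.mul ha.2⟩
  | inv a _ ha => rw [inv_inv]; exact ⟨ha.2, ha.1⟩

theorem refl_mem_weylGroup {m : ℕ} {Δ : Set (E m)} {r : E m} (hr : r ∈ Δ) :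
    refl r ∈ weylGroup Δ :=
  Subgroup.subset_closure (Set.mem_image_of_mem refl hr)

theorem h_mem_shortB {n : ℕ} (i : Fin n) : h i ∈ shortB n :=
  ⟨i, 1, Or.inl rfl, (one_smul _ _).symm⟩

/-- Every signed permutation of the coordinates belongs to the Weyl group of type `Bₙ`. -/
theorem exists_mem_weylGroupB {n : ℕ} (π : Equiv.Perm (Fin n)) {s : Fin n → ℝ}
    (hs : ∀ k, s k = 1 ∨ s k = -1) :
    ∃ w ∈ weylGroup (rootsB n), ∀ k, w (h k) = s k • h (π k) := by
  classical
  have hsign : ∀ S : Finset (Fin n), ∃ w ∈ weylGroup (rootsB n),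
      ∀ k, w (h k) = if k ∈ S then -h k else h k := by
    intro S
    induction S using Finset.induction_on with
    | empty => exact ⟨1, one_mem _, fun k => by simp⟩
    | insert i S hi ih =>
      obtain ⟨w, hw, hwk⟩ := ih
      refine ⟨refl (h i) * w, mul_mem (refl_mem_weylGroup
        (mem_rootsB.mpr (Or.inl (h_mem_shortB i)))) hw, fun k => ?_⟩
      change refl (h i) (w (h k)) = _
      rw [hwk]
      rcases eq_or_ne k i with rfl | hk
      · simp [hi, refl_short_h]
      · by_cases hkS : k ∈ S <;> simp [hk, hkS, refl_short_h]
  obtain ⟨w, hw, hwk⟩ := hsign (Finset.univ.filter fun k => s k = -1)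
  have hπ : permIso π ∈ weylGroup (rootsB n) := permIso_mem_of_refl_mem (fun i j hij =>
    refl_mem_weylGroup (mem_rootsB.mpr (Or.inr
      ⟨i, j, 1, -1, hij, Or.inl rfl, Or.inr rfl, by simp [sub_eq_add_neg]⟩))) π
  refine ⟨permIso π * w, mul_mem hπ hw, fun k => ?_⟩
  change permIso π (w (h k)) = _
  rw [hwk]
  rcases hs k with hk | hk
  · rw [if_neg (by simp [hk]; norm_num), hk, one_smul, permIso_h]
  · rw [if_pos (by simp [hk]), hk, map_neg, permIso_h, neg_smul, one_smul]

/-- With `v k ≠ 0`, the difference of `h k` and its image is a multiple of `v`: twice a short root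
if `h k` is negated, a long root otherwise. -/
theorem exists_smul_mem_rootsB {n : ℕ} {v : E n} (hv : v ≠ 0)
    (hw : refl v ∈ weylGroup (rootsB n)) : ∃ c : ℝ, c ≠ 0 ∧ c • v ∈ rootsB n := by
  obtain ⟨k, hk⟩ := exists_apply_ne_zero hv
  obtain ⟨j, s, hs, h1⟩ := isSignedPerm_of_mem_weylGroupB hw k
  obtain ⟨c, hc, hcv⟩ := exists_smul_eq_sub_of_refl_eq h1 (by rwa [inner_h_right])
  rcases eq_or_ne k j with rfl | hkj
  · rcases hs with rfl | rfl
    · rw [one_smul, sub_self, smul_eq_zero] at hcv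
      exact absurd hcv (not_or.mpr ⟨hc, hv⟩)
    · refine ⟨c / 2, by positivity, mem_rootsB.mpr (Or.inl ⟨k, 1, Or.inl rfl, ?_⟩)⟩
      rw [div_eq_inv_mul, mul_smul, hcv, neg_smul, one_smul, sub_neg_eq_add, ← two_smul ℝ,
        smul_smul]
      norm_num
  · exact ⟨c, hc, mem_rootsB.mpr (Or.inr ⟨k, j, 1, -s, hkj, Or.inl rfl, neg_sign hs, by
      rw [hcv, one_smul, neg_smul, sub_eq_add_neg]⟩)⟩

/-! ### Integral vectors and the roots of type `Bₙ` -/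

theorem sign_smul_mem_iff {n : ℕ} (L : AddSubgroup (E n)) {s : ℝ} (hs : s = 1 ∨ s = -1) (x : E n) :
    s • x ∈ L ↔ x ∈ L := by
  rcases hs with rfl | rfl <;> simp

theorem rootsB_subset_intLattice {n : ℕ} : rootsB n ⊆ (intLattice n : Set (E n)) := by
  intro r hr
  rcases mem_rootsB.mp hr with ⟨i, s, hs, rfl⟩ | ⟨i, j, s, t, hij, hs, ht, rfl⟩
  · exact (sign_smul_mem_iff _ hs _).mpr (h_mem_intLattice i)
  · exact add_mem ((sign_smul_mem_iff _ hs _).mpr (h_mem_intLattice i))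
      ((sign_smul_mem_iff _ ht _).mpr (h_mem_intLattice j))

theorem exists_int_inner {n : ℕ} {x y : E n} (hx : x ∈ intLattice n) (hy : y ∈ intLattice n) :
    ∃ z : ℤ, inner ℝ x y = z := by
  choose a ha using hx
  choose b hb using hy
  refine ⟨∑ k, b k * a k, ?_⟩
  simp [PiLp.inner_apply, ha, hb]

/-- A nonzero coordinate has `s * x k ≥ 1` for some sign `s`, so `‖x - s • h k‖ ^ 2 = 2 - 2 * (s * x
k) ≤ 0`. -/
theorem exists_sign_of_intLattice {n : ℕ} {x : E n} (hx : x ∈ intLattice n) (h1 : ‖x‖ ^ 2 = 1) :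
    ∃ (i : Fin n) (s : ℝ), (s = 1 ∨ s = -1) ∧ x = s • h i := by
  have hx0 : x ≠ 0 := by rintro rfl; simp at h1
  obtain ⟨k, hk⟩ := exists_apply_ne_zero hx0
  obtain ⟨z, hz⟩ := hx k
  obtain ⟨s, hs, hsz⟩ : ∃ s : ℝ, (s = 1 ∨ s = -1) ∧ 1 ≤ s * x k := by
    rw [hz] at hk ⊢
    have hz0 : z ≠ 0 := Int.cast_ne_zero.mp hk
    rcases lt_or_gt_of_ne hz0 with hlt | hgt
    · have : z ≤ -1 := by omega
      have : (z : ℝ) ≤ ((-1 : ℤ) : ℝ) := Int.cast_le.mpr this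
      push_cast at this
      exact ⟨-1, Or.inr rfl, by linarith⟩
    · have : (1 : ℝ) ≤ z := by exact_mod_cast hgt
      exact ⟨1, Or.inl rfl, by linarith⟩
  refine ⟨k, s, hs, ?_⟩
  have h2 := norm_sub_sq_real x (s • h k)
  rw [h1, norm_sq_of_mem_shortB ⟨k, s, hs, rfl⟩, real_inner_smul_right, inner_h_right] at h2
  have h0 : ‖x - s • h k‖ = 0 := by
    have := sq_nonneg ‖x - s • h k‖
    exact pow_eq_zero_iff two_ne_zero |>.mp (by linarith)
  exact sub_eq_zero.mp (norm_eq_zero.mp h0)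

theorem norm_sq_of_mem_rootsB {n : ℕ} {r : E n} (hr : r ∈ rootsB n) :
    ‖r‖ ^ 2 = 1 ∨ ‖r‖ ^ 2 = 2 :=
  (mem_rootsB.mp hr).imp norm_sq_of_mem_shortB norm_sq_of_mem_longB

/-- Non-proportional, non-orthogonal roots have inner product `±1`. -/
theorem inner_sq_eq_one_of_mem_rootsB {n : ℕ} {u v : E n} (hu : u ∈ rootsB n) (hv : v ∈ rootsB n)
    (h1 : u ≠ v) (h2 : u ≠ -v) (h0 : inner ℝ u v ≠ 0) : (inner ℝ u v) ^ 2 = 1 := by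
  obtain ⟨z, hz⟩ := exists_int_inner (rootsB_subset_intLattice hu) (rootsB_subset_intLattice hv)
  -- Positivity of `‖u ± v‖ ^ 2`, with both squared norms at most 2, forces the integer `z` into
  -- (-2, 2).
  have e1 := norm_sub_sq_real u v
  have e2 := norm_add_sq_real u v
  have p1 : 0 < ‖u - v‖ ^ 2 := by
    have := norm_pos_iff.mpr (sub_ne_zero.mpr h1)
    positivity
  have p2 : 0 < ‖u + v‖ ^ 2 := by
    have : u + v ≠ 0 := fun hh => h2 (eq_neg_of_add_eq_zero_left hh)
    have := norm_pos_iff.mpr this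
    positivity
  have b1 : ‖u‖ ^ 2 ≤ 2 := by rcases norm_sq_of_mem_rootsB hu with h | h <;> rw [h]; norm_num
  have b2 : ‖v‖ ^ 2 ≤ 2 := by rcases norm_sq_of_mem_rootsB hv with h | h <;> rw [h]; norm_num
  rw [hz] at e1 e2 h0 ⊢
  have q1 : (z : ℝ) < 2 := by linarith
  have q2 : (-2 : ℝ) < z := by linarith
  have q1' : z < 2 := by exact_mod_cast q1
  have q2' : -2 < z := by exact_mod_cast q2
  have q0 : z ≠ 0 := Int.cast_ne_zero.mp h0
  have : z = 1 ∨ z = -1 := by omega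
  rcases this with rfl | rfl <;> norm_num

/-! ### Existence in type `Bₙ` -/

theorem linearIsometry_surjective {n : ℕ} (φ : E n →ₗᵢ[ℝ] E n) : Function.Surjective φ :=
  (LinearMap.injective_iff_surjective (f := φ.toLinearMap)).mp φ.injective

theorem refl_map_eq_of_intertwining_of_surjective {n : ℕ} (φ : E n →ₗᵢ[ℝ] E n) {v : E n}
    {w : E n ≃ₗᵢ[ℝ] E n} (hw : ∀ x, φ (refl v x) = w (φ x)) : refl (φ v) = w := by
  ext1 x
  obtain ⟨y, rfl⟩ := linearIsometry_surjective φ x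
  rw [← map_refl, hw]

theorem coxeterB_apply {n : ℕ} (i j : Fin n) : (CoxeterMatrix.B n) i j =
    if (i : ℕ) = j then 1
    else if (i : ℕ) = n - 1 ∧ (j : ℕ) = n - 2 ∨ (j : ℕ) = n - 1 ∧ (i : ℕ) = n - 2 then 4
    else if (j : ℕ) + 1 = i ∨ (i : ℕ) + 1 = j then 3 else 2 := by
  simp [CoxeterMatrix.B, Fin.ext_iff]

/-- The unit normals of a Coxeter simplex of type `Bₙ` can be identified with normalized
roots. -/
theorem exists_embedding_coxeterB {n : ℕ} {e : Fin n → E n}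
    (he : IsCoxeterSimplex (CoxeterMatrix.B n) e) :
    ∃ φ : E n →ₗᵢ[ℝ] E n, ∀ i, ∃ c : ℝ, c ≠ 0 ∧ c • φ (e i) ∈ rootsB n := by
  have hs : Real.sqrt 2 * Real.sqrt 2 = 2 := Real.mul_self_sqrt zero_le_two
  have hs0 : Real.sqrt 2 ≠ 0 := by positivity
  have hs2 : (Real.sqrt 2)⁻¹ = Real.sqrt 2 / 2 := by field_simp; linarith
  obtain ⟨φ, hφ⟩ := exists_linearIsometry_of_gram he.1
    -- Simple roots: the last index, without a successor, carries the short one, already a unit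
    -- vector.
    (fun i : Fin n => if hi : (i : ℕ) + 1 < n then
      (Real.sqrt 2)⁻¹ • ((h i : E n) - h ⟨i + 1, hi⟩) else h i) (by
    intro i j
    rw [he.2, coxeterB_apply]
    have hin := i.2
    have hjn := j.2
    by_cases hi : (i : ℕ) + 1 < n <;> by_cases hj : (j : ℕ) + 1 < n
    · rw [dif_pos hi, dif_pos hj, real_inner_smul_left, real_inner_smul_right, inner_sub_left,
        inner_h_left, inner_h_left, ← mul_assoc, ← mul_inv, hs]
      simp only [PiLp.sub_apply, h_apply, Fin.ext_iff]
      rw [if_neg (show ¬((i : ℕ) = n - 1 ∧ (j : ℕ) = n - 2 ∨ (j : ℕ) = n - 1 ∧ (i : ℕ) = n - 2)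
        by omega)]
      by_cases h1 : (i : ℕ) = j
      · simp [h1]; norm_num
      · by_cases h2 : (j : ℕ) + 1 = i
        · simp [h2.symm, show ¬(j : ℕ) + 1 + 1 = j by omega]
        · by_cases h3 : (i : ℕ) + 1 = j
          · simp [h3.symm, show (i : ℕ) ≠ i + 1 + 1 by omega]
          · simp [h1, h2, h3, Ne.symm h2]
    · rw [dif_pos hi, dif_neg hj, real_inner_smul_left, inner_h_right, hs2]
      simp only [PiLp.sub_apply, h_apply, Fin.ext_iff]
      rw [if_neg (show ¬(j : ℕ) = i by omega), if_neg (show ¬(i : ℕ) = j by omega)]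
      by_cases h1 : (j : ℕ) = i + 1
      · rw [if_pos h1,
          if_pos (show (i : ℕ) = n - 1 ∧ (j : ℕ) = n - 2 ∨ (j : ℕ) = n - 1 ∧ (i : ℕ) = n - 2
          by omega)]
        simp
      · rw [if_neg h1,
          if_neg (show ¬((i : ℕ) = n - 1 ∧ (j : ℕ) = n - 2 ∨ (j : ℕ) = n - 1 ∧ (i : ℕ) = n - 2)
          by omega),
          if_neg (show ¬((j : ℕ) + 1 = i ∨ (i : ℕ) + 1 = j) by omega)]
        simp
    · rw [dif_neg hi, dif_pos hj, real_inner_smul_right, inner_h_left, hs2]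
      simp only [PiLp.sub_apply, h_apply, Fin.ext_iff]
      rw [if_neg (show ¬(i : ℕ) = j by omega)]
      by_cases h1 : (i : ℕ) = j + 1
      · rw [if_pos h1,
          if_pos (show (i : ℕ) = n - 1 ∧ (j : ℕ) = n - 2 ∨ (j : ℕ) = n - 1 ∧ (i : ℕ) = n - 2
          by omega)]
        simp [show ¬(i : ℕ) = j by omega]
      · rw [if_neg h1,
          if_neg (show ¬((i : ℕ) = n - 1 ∧ (j : ℕ) = n - 2 ∨ (j : ℕ) = n - 1 ∧ (i : ℕ) = n - 2)
          by omega),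
          if_neg (show ¬((j : ℕ) + 1 = i ∨ (i : ℕ) + 1 = j) by omega)]
        simp [show ¬(i : ℕ) = j by omega]
    · rw [dif_neg hi, dif_neg hj, inner_h_left, h_apply, if_pos (by omega), if_pos (by omega)]
      simp)
  refine ⟨φ, fun i => ?_⟩
  rw [hφ]
  split_ifs with hi
  · refine ⟨Real.sqrt 2, hs0, mem_rootsB.mpr (Or.inr
      ⟨i, ⟨i + 1, hi⟩, 1, -1, ?_, Or.inl rfl, Or.inr rfl, ?_⟩)⟩
    · simp [Fin.ext_iff]
    · rw [smul_smul, mul_inv_cancel₀ hs0, one_smul, one_smul, neg_smul, one_smul, sub_eq_add_neg]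
  · exact ⟨1, one_ne_zero, mem_rootsB.mpr (Or.inl ⟨i, 1, Or.inl rfl, rfl⟩)⟩

theorem exists_isEmbedding_B {n : ℕ} {Φ : Set (Set (E n))} (hΦ : IsFamily Φ)
    (hgen : Generates Φ (CoxeterMatrix.B n)) : ∃ R, IsEmbedding Φ (rootsB n) R := by
  obtain ⟨f, hf⟩ := hΦ
  obtain ⟨e, he, hG⟩ := hgen
  obtain ⟨φ, hφ⟩ := exists_embedding_coxeterB he
  have key : ∀ i, ∃ c : ℝ, c ≠ 0 ∧ c • φ (f i) ∈ rootsB n := by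
    intro i
    have hmem := refl_mem_generatedGroup hf i
    rw [hG] at hmem
    obtain ⟨w, hw, hw'⟩ := exists_weylGroup_intertwining φ (Δ := rootsB n) (by
      rintro _ ⟨j, rfl⟩
      obtain ⟨c, hc, hcr⟩ := hφ j
      exact ⟨c • e j, (refl_smul hc _).symm, by rwa [map_smul]⟩) hmem
    rw [← refl_map_eq_of_intertwining_of_surjective φ hw'] at hw
    exact exists_smul_mem_rootsB ((map_ne_zero_iff φ φ.injective).mpr (hf.1.ne_zero i)) hw
  choose c hc hr using key
  refine ⟨_, ?_, φ, fun i => c i • f i, hf.smul hc, rfl⟩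
  rintro _ ⟨i, rfl | rfl⟩
  · rw [map_smul]; exact hr i
  · rw [map_smul]; exact neg_mem_rootsB (hr i)

/-! ### Irreducible systems of vectors -/

/-- A system of vectors is irreducible if there is no nontrivial orthogonal decomposition of the
space compatible with it. -/
def IsIrreducibleSystem {ι : Type*} {n : ℕ} (f : ι → E n) : Prop :=
  ∀ V : Submodule ℝ (E n), (∀ k, f k ∈ V ∨ f k ∈ Vᗮ) → V = ⊥ ∨ V = ⊤

theorem refl_apply_mem {n : ℕ} {V : Submodule ℝ (E n)} {v : E n} (hv : v ∈ V ∨ v ∈ Vᗮ) {x : E n}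
    (hx : x ∈ V) : refl v x ∈ V := by
  rw [refl_apply]
  rcases hv with hv | hv
  · exact V.sub_mem hx (V.smul_mem _ hv)
  · rw [real_inner_comm, (V.mem_orthogonal v).mp hv x hx]
    simpa using hx

/-- If some `x` in `V` is not orthogonal to `v`, then `x - refl v x` is a nonzero multiple of `v` in
`V`. -/
theorem mem_or_mem_orthogonal_of_refl {n : ℕ} {V : Submodule ℝ (E n)} {v : E n}
    (hv : ∀ x ∈ V, refl v x ∈ V) : v ∈ V ∨ v ∈ Vᗮ := by
  by_cases hall : ∀ x ∈ V, inner ℝ x v = 0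
  · exact Or.inr ((V.mem_orthogonal v).mpr hall)
  · push Not at hall
    obtain ⟨x, hx, hxv⟩ := hall
    obtain ⟨c, hc, hcv⟩ := exists_smul_eq_sub_of_refl_eq (rfl : refl v x = _)
      (by rwa [real_inner_comm])
    refine Or.inl ((V.smul_mem_iff hc).mp ?_)
    rw [hcv]
    exact V.sub_mem hx (hv x hx)

theorem apply_mem_of_mem_closure {n : ℕ} {V : Submodule ℝ (E n)} {S : Set (E n)}
    (hS : ∀ v ∈ S, v ∈ V ∨ v ∈ Vᗮ) {g : E n ≃ₗᵢ[ℝ] E n}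
    (hg : g ∈ Subgroup.closure (refl '' S)) : ∀ x ∈ V, g x ∈ V := by
  suffices (∀ x ∈ V, g x ∈ V) ∧ ∀ x ∈ V, g⁻¹ x ∈ V from this.1
  induction hg using Subgroup.closure_induction with
  | mem s hs =>
    obtain ⟨v, hv, rfl⟩ := hs
    rw [refl_inv]
    exact ⟨fun x => refl_apply_mem (hS v hv), fun x => refl_apply_mem (hS v hv)⟩
  | one => rw [inv_one]; exact ⟨fun x hx => hx, fun x hx => hx⟩
  | mul a b _ _ ha hb =>
    rw [mul_inv_rev]
    exact ⟨fun x hx => ha.1 _ (hb.1 x hx), fun x hx => hb.2 _ (ha.2 x hx)⟩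
  | inv a _ ha => rw [inv_inv]; exact ⟨ha.2, ha.1⟩

theorem coxeterB_adjacent_inner_ne_zero {n : ℕ} {e : Fin n → E n}
    (he : IsCoxeterSimplex (CoxeterMatrix.B n) e) {i j : Fin n} (hij : (i : ℕ) + 1 = j) :
    inner ℝ (e i) (e j) ≠ 0 := by
  rw [he.2, coxeterB_apply, if_neg (by omega), neg_ne_zero]
  split_ifs
  · have : Real.cos (Real.pi / ((4 : ℕ) : ℝ)) = Real.sqrt 2 / 2 := by
      push_cast; exact Real.cos_pi_div_four
    rw [this]
    positivity
  · have : Real.cos (Real.pi / ((3 : ℕ) : ℝ)) = 1 / 2 := by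
      push_cast; exact Real.cos_pi_div_three
    rw [this]
    norm_num
  · omega

/-- The diagram is a path, and adjacent normals are not orthogonal, so membership in `V` spreads to
all normals. -/
theorem isIrreducibleSystem_coxeterB {n : ℕ} {e : Fin n → E n}
    (he : IsCoxeterSimplex (CoxeterMatrix.B n) e) : IsIrreducibleSystem e := by
  intro V hV
  have hstep : ∀ i j : Fin n, (i : ℕ) + 1 = j → (e i ∈ V ↔ e j ∈ V) := by
    intro i j hij
    have hne := coxeterB_adjacent_inner_ne_zero he hij
    constructor
    · intro hi
      exact (hV j).resolve_right fun hj => hne ((V.mem_orthogonal _).mp hj _ hi)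
    · intro hj
      refine (hV i).resolve_right fun hi => hne ?_
      rw [real_inner_comm]
      exact (V.mem_orthogonal _).mp hi _ hj
  have hall : ∀ i : Fin n, e i ∈ V ↔ e ⟨0, i.pos⟩ ∈ V := by
    rintro ⟨i, hi⟩
    induction i with
    | zero => rfl
    | succ k ih => exact (hstep ⟨k, by omega⟩ ⟨k + 1, hi⟩ rfl).symm.trans (ih (by omega))
  by_cases h0 : ∃ i, e i ∈ V
  · right
    obtain ⟨i, hi⟩ := h0
    rw [eq_top_iff, ← span_range_eq_top he.1, Submodule.span_le]
    rintro _ ⟨j, rfl⟩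
    exact (hall j).mpr ((hall i).mp hi)
  · left
    push Not at h0
    rw [eq_bot_iff]
    intro x hx
    rw [Submodule.mem_bot]
    refine eq_zero_of_forall_inner_eq_zero he.1 fun k => ?_
    rw [real_inner_comm]
    exact (V.mem_orthogonal _).mp ((hV k).resolve_left (h0 k)) x hx

/-- Irreducibility depends only on the group: a `V` compatible with `f` is stable under the group,
hence compatible with `e`. -/
theorem isIrreducibleSystem_of_generates {n : ℕ} {Φ : Set (Set (E n))} {f : Fin n → E n}
    (hf : IsRepresentedBy Φ f) (hgen : Generates Φ (CoxeterMatrix.B n)) :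
    IsIrreducibleSystem f := by
  obtain ⟨e, he, hG⟩ := hgen
  rw [generatedGroup_eq hf] at hG
  intro V hV
  refine isIrreducibleSystem_coxeterB he V fun k => mem_or_mem_orthogonal_of_refl ?_
  have hk : refl (e k) ∈ Subgroup.closure (refl '' Set.range f) := by
    rw [← Set.range_comp]
    have : refl (e k) ∈ Subgroup.closure (Set.range fun i => refl (e i)) :=
      Subgroup.subset_closure ⟨k, rfl⟩
    rwa [← hG] at this
  exact apply_mem_of_mem_closure (by rintro _ ⟨i, rfl⟩; exact hV i) hk

theorem IsIrreducibleSystem.map {ι : Type*} {n : ℕ} {f : ι → E n} (hf : IsIrreducibleSystem f)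
    (φ : E n →ₗᵢ[ℝ] E n) : IsIrreducibleSystem fun i => φ (f i) := by
  intro V hV
  have hsurj := linearIsometry_surjective φ
  have := hf (V.comap φ.toLinearMap) fun k => (hV k).imp id fun hk => by
    rw [Submodule.mem_orthogonal]
    intro x hx
    rw [← φ.inner_map_map]
    exact (V.mem_orthogonal _).mp hk _ hx
  rcases this with h0 | h0
  · left
    rw [eq_bot_iff]
    intro x hx
    obtain ⟨y, rfl⟩ := hsurj x
    have hy : y ∈ V.comap φ.toLinearMap := hx
    rw [h0, Submodule.mem_bot] at hy
    rw [hy, map_zero]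
    exact zero_mem _
  · right
    rw [eq_top_iff]
    intro x _
    obtain ⟨y, rfl⟩ := hsurj x
    have hy : y ∈ V.comap φ.toLinearMap := by rw [h0]; trivial
    exact hy

theorem IsIrreducibleSystem.comp_perm {ι : Type*} {n : ℕ} {f : ι → E n}
    (hf : IsIrreducibleSystem f) (σ : Equiv.Perm ι) : IsIrreducibleSystem fun i => f (σ i) :=
  fun V hV => hf V fun k => by simpa using hV (σ.symm k)

/-! ### Short roots in a generating system of type `Bₙ` -/

/-- A long reflection exchanges two coordinates and changes the signs of both or neither. A short
one negates a single coordinate, so it cannot lie in this group. -/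
theorem prod_apply_of_mem_weylGroup_longB {n : ℕ} {w : E n ≃ₗᵢ[ℝ] E n}
    (hw : w ∈ weylGroup (longB n)) : ∀ x : E n, ∏ k, w x k = ∏ k, x k := by
  induction hw using Subgroup.closure_induction with
  | mem s hs =>
    obtain ⟨_, ⟨i, j, s, t, hij, hs, ht, rfl⟩, rfl⟩ := hs
    intro x
    rw [refl_long_apply hij hs ht]
    have hj : j ∈ Finset.univ.erase i := by simp [hij.symm]
    rw [← Finset.mul_prod_erase _ _ (Finset.mem_univ i), ← Finset.mul_prod_erase _ _ hj,
      ← Finset.mul_prod_erase Finset.univ (fun k => x k) (Finset.mem_univ i),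
      ← Finset.mul_prod_erase _ _ hj, ← mul_assoc, ← mul_assoc]
    congr 1
    · simp only [PiLp.sub_apply, PiLp.smul_apply, PiLp.add_apply, h_apply, smul_eq_mul, if_true,
        if_neg hij, if_neg hij.symm]
      rcases hs with rfl | rfl <;> rcases ht with rfl | rfl <;> ring
    · refine Finset.prod_congr rfl fun k hk => ?_
      simp only [Finset.mem_erase] at hk
      simp [h_apply, hk.1, hk.2.1]
  | one => intro x; rfl
  | mul a b _ _ ha hb => intro x; exact (ha (b x)).trans (hb x)
  | inv a _ ha =>
    intro x
    have h1 := ha (a⁻¹ x)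
    have h2 : a (a⁻¹ x) = x := a.apply_symm_apply x
    rw [h2] at h1
    exact h1.symm

theorem refl_notMem_weylGroup_longB {n : ℕ} {r : E n} (hr : r ∈ shortB n) :
    refl r ∉ weylGroup (longB n) := by
  obtain ⟨i, s, hs, rfl⟩ := hr
  rw [refl_smul (by rintro rfl; norm_num at hs)]
  intro hw
  have h1 := prod_apply_of_mem_weylGroup_longB hw (ones n)
  have h2 : ∀ k, refl (h i) (ones n) k = if k = i then -1 else 1 := by
    intro k
    rw [refl_apply, norm_sq_of_mem_shortB (h_mem_shortB i), inner_h_left]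
    simp only [PiLp.sub_apply, PiLp.smul_apply, h_apply, ones_apply, smul_eq_mul]
    split_ifs <;> norm_num
  simp only [h2, ones_apply, Finset.prod_const_one] at h1
  rw [Finset.prod_ite_eq'] at h1
  norm_num at h1

/-- If all roots were long, every `e i` would be proportional to a long root. The last two normals
meet at cosine `-√2/2`, so the corresponding long roots would have an integral inner product with
square 2. -/
theorem exists_mem_shortB {n : ℕ} (hn : 2 ≤ n) {Φ : Set (Set (E n))} {f : Fin n → E n}
    (hf : IsRepresentedBy Φ f) (hgen : Generates Φ (CoxeterMatrix.B n)) (φ : E n →ₗᵢ[ℝ] E n)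
    (hr : ∀ k, φ (f k) ∈ rootsB n) : ∃ k, φ (f k) ∈ shortB n := by
  by_contra! hshort
  have hlong : ∀ k, φ (f k) ∈ longB n := fun k =>
    (mem_rootsB.mp (hr k)).resolve_left (hshort k)
  obtain ⟨e, he, hG⟩ := hgen
  rw [generatedGroup_eq hf] at hG
  have key : ∀ i, ∃ c : ℝ, c • φ (e i) ∈ longB n := by
    intro i
    have hmem : refl (e i) ∈ Subgroup.closure (Set.range fun i => refl (e i)) :=
      Subgroup.subset_closure ⟨i, rfl⟩
    rw [← hG] at hmem
    obtain ⟨w, hw, hw'⟩ := exists_weylGroup_intertwining φ (Δ := longB n) (by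
      rintro _ ⟨j, rfl⟩
      exact ⟨f j, rfl, hlong j⟩) hmem
    rw [← refl_map_eq_of_intertwining_of_surjective φ hw'] at hw
    have hsub : weylGroup (longB n) ≤ weylGroup (rootsB n) :=
      Subgroup.closure_mono (Set.image_mono fun r hr => mem_rootsB.mpr (Or.inr hr))
    obtain ⟨c, hc, hcr⟩ := exists_smul_mem_rootsB
      ((map_ne_zero_iff φ φ.injective).mpr (he.1.ne_zero i)) (hsub hw)
    refine ⟨c, (mem_rootsB.mp hcr).resolve_left fun hs => ?_⟩
    have := refl_notMem_weylGroup_longB hs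
    rw [refl_smul hc] at this
    exact this hw
  obtain ⟨c, hc⟩ := key ⟨n - 2, by omega⟩
  obtain ⟨d, hd⟩ := key ⟨n - 1, by omega⟩
  have hnorm : ∀ i, ‖φ (e i)‖ ^ 2 = 1 := by
    intro i
    rw [φ.norm_map, ← real_inner_self_eq_norm_sq, he.2, coxeterB_apply, if_pos rfl]
    simp
  have hc2 := norm_sq_of_mem_longB hc
  have hd2 := norm_sq_of_mem_longB hd
  rw [norm_smul, mul_pow, hnorm, Real.norm_eq_abs, sq_abs, mul_one] at hc2 hd2
  obtain ⟨z, hz⟩ := exists_int_inner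
    (rootsB_subset_intLattice (mem_rootsB.mpr (Or.inr hc)))
    (rootsB_subset_intLattice (mem_rootsB.mpr (Or.inr hd)))
  have hM : inner ℝ (e ⟨n - 2, by omega⟩) (e ⟨n - 1, by omega⟩) = -(Real.sqrt 2 / 2) := by
    rw [he.2, coxeterB_apply, if_neg (by simp; omega), if_pos (by simp), ← Real.cos_pi_div_four]
    norm_num
  rw [real_inner_smul_left, real_inner_smul_right, φ.inner_map_map, hM] at hz
  have hs : Real.sqrt 2 * Real.sqrt 2 = 2 := Real.mul_self_sqrt zero_le_two
  have hz2 : (z : ℝ) ^ 2 = 2 := by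
    rw [← hz]
    calc (c * (d * -(Real.sqrt 2 / 2))) ^ 2 = c ^ 2 * d ^ 2 * (Real.sqrt 2 * Real.sqrt 2) / 4 := by
          ring
      _ = 2 := by rw [hc2, hd2, hs]; norm_num
  have hz3 : z ^ 2 = 2 := by exact_mod_cast hz2
  have h1 : z < 2 := by nlinarith
  have h2 : -2 < z := by nlinarith
  interval_cases z <;> omega

/-- A subgroup containing a short root, and all the long roots of an irreducible system of roots,
contains the standard basis. -/
theorem h_mem_of_isIrreducibleSystem {ι : Type*} {n : ℕ} {r : ι → E n}
    (hirr : IsIrreducibleSystem r) (hr : ∀ k, r k ∈ rootsB n) (L : AddSubgroup (E n))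
    (hL : ∀ k, r k ∈ L ∨ r k ∈ shortB n) (hs : ∃ x ∈ shortB n, x ∈ L) (i : Fin n) : h i ∈ L := by
  -- `V` is spanned by the `h i` in `L`. A long root in `L` involves two such vectors or none, so
  -- `V` splits the system; the short root makes it nonzero.
  let V : Submodule ℝ (E n) :=
    { carrier := {x | ∀ i, h i ∉ L → x i = 0}
      zero_mem' := fun i _ => rfl
      add_mem' := fun {x y} hx hy i hi => by simp [hx i hi, hy i hi]
      smul_mem' := fun c x hx i hi => by simp [hx i hi] }
  have hmem : ∀ i, h i ∈ L → h i ∈ V := by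
    intro i hi j hj
    rw [h_apply, if_neg]
    rintro rfl
    exact hj hi
  have horth : ∀ i, h i ∉ L → h i ∈ Vᗮ := by
    intro i hi
    rw [Submodule.mem_orthogonal]
    intro x hx
    rw [inner_h_right]
    exact hx i hi
  have hV := hirr V (by
    intro k
    by_cases hk : r k ∈ shortB n
    · obtain ⟨i, s, -, hi⟩ := hk
      rw [hi]
      by_cases hiL : h i ∈ L
      · exact Or.inl (V.smul_mem _ (hmem i hiL))
      · exact Or.inr (Vᗮ.smul_mem _ (horth i hiL))
    · have hkL := (hL k).resolve_right hk
      obtain ⟨i, j, s, t, -, hs, ht, hij⟩ := (mem_rootsB.mp (hr k)).resolve_left hk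
      rw [hij] at hkL ⊢
      have hiff : h i ∈ L ↔ h j ∈ L := by
        rw [← sign_smul_mem_iff L hs (h i), ← sign_smul_mem_iff L ht (h j)]
        constructor
        · intro hi; exact (L.add_mem_cancel_left hi).mp hkL
        · intro hj; exact (L.add_mem_cancel_right hj).mp hkL
      by_cases hiL : h i ∈ L
      · exact Or.inl (V.add_mem (V.smul_mem _ (hmem i hiL)) (V.smul_mem _ (hmem j (hiff.mp hiL))))
      · exact Or.inr (Vᗮ.add_mem (Vᗮ.smul_mem _ (horth i hiL))
          (Vᗮ.smul_mem _ (horth j fun hj => hiL (hiff.mpr hj)))))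
  rcases hV with hV | hV
  · obtain ⟨_, ⟨j, s, hs, rfl⟩, hj⟩ := hs
    have := hmem j ((sign_smul_mem_iff L hs _).mp hj)
    rw [hV, Submodule.mem_bot] at this
    have h1 := norm_sq_of_mem_shortB (h_mem_shortB j)
    rw [this] at h1
    simp at h1
  · by_contra hi
    have h1 : h i ∈ V := by rw [hV]; trivial
    have h2 := h1 i hi
    rw [h_apply, if_pos rfl] at h2
    exact one_ne_zero h2

/-- With a second short root present, the roots other than `r l` already generate a lattice
containing `r l`, against independence. -/
theorem eq_of_mem_shortB {ι : Type*} {n : ℕ} {r : ι → E n} (hli : LinearIndependent ℝ r)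
    (hirr : IsIrreducibleSystem r) (hr : ∀ k, r k ∈ rootsB n) {k l : ι} (hk : r k ∈ shortB n)
    (hl : r l ∈ shortB n) : k = l := by
  by_contra hkl
  let L := AddSubgroup.closure (r '' {l}ᶜ)
  have hmem : ∀ j, j ≠ l → r j ∈ L := fun j hj => AddSubgroup.subset_closure ⟨j, hj, rfl⟩
  have hL : L ≤ (Submodule.span ℝ (r '' {l}ᶜ)).toAddSubgroup :=
    (AddSubgroup.closure_le _).mpr Submodule.subset_span
  obtain ⟨i, s, hs, hi⟩ := id hl
  have hil : h i ∈ L := h_mem_of_isIrreducibleSystem hirr hr L (fun j => by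
    rcases eq_or_ne j l with rfl | hj
    · exact Or.inr hl
    · exact Or.inl (hmem j hj)) ⟨r k, hk, hmem k hkl⟩ i
  have hlL : r l ∈ L := by rw [hi]; exact (sign_smul_mem_iff L hs _).mpr hil
  exact hli.notMem_span_image (s := {l}ᶜ) (x := l) (by simp) (hL hlL)

/-! ### Uniqueness in type `Bₙ` -/

/-- Two systems of roots with the same Gram matrix, the first of which generates the lattice
`ℤⁿ`, differ by an element of the Weyl group. -/
theorem exists_weylGroup_of_gram_eq {n : ℕ} {r r' : Fin n → E n} (hli : LinearIndependent ℝ r)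
    (hr' : ∀ k, r' k ∈ rootsB n) (hL : ∀ i, h i ∈ AddSubgroup.closure (Set.range r))
    (hgram : ∀ i j, inner ℝ (r' i) (r' j) = inner ℝ (r i) (r j)) :
    ∃ w ∈ weylGroup (rootsB n), ∀ k, r' k = w (r k) := by
  obtain ⟨ψ, hψ⟩ := exists_linearIsometry_of_gram hli r' hgram
  have hlat : ∀ x ∈ AddSubgroup.closure (Set.range r), ψ x ∈ intLattice n := by
    intro x hx
    induction hx using AddSubgroup.closure_induction with
    | mem x hx =>
      obtain ⟨k, rfl⟩ := hx
      rw [hψ]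
      exact rootsB_subset_intLattice (hr' k)
    | zero => rw [map_zero]; exact zero_mem _
    | add a b _ _ ha hb => rw [map_add]; exact add_mem ha hb
    | neg a _ ha => rw [map_neg]; exact neg_mem ha
  -- `ψ` maps `ℤⁿ` into itself, and the integral unit vectors are exactly the `± h j`.
  have hsign : ∀ i, ∃ (j : Fin n) (s : ℝ), (s = 1 ∨ s = -1) ∧ ψ (h i) = s • h j := fun i =>
    exists_sign_of_intLattice (hlat _ (hL i))
      (by rw [ψ.norm_map, norm_sq_of_mem_shortB (h_mem_shortB i)])
  choose π s hs hπ using hsign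
  have hinj : Function.Injective π := by
    intro i j hij
    by_contra hne
    have h1 := ψ.inner_map_map (h i) (h j)
    rw [hπ, hπ, hij, inner_h_left, h_apply, if_neg hne, real_inner_smul_left,
      real_inner_smul_right, inner_h_left, h_apply, if_pos rfl, mul_one] at h1
    rcases hs i with hi | hi <;> rcases hs j with hj | hj <;> rw [hi, hj] at h1 <;> norm_num at h1
  obtain ⟨w, hw, hwh⟩ := exists_mem_weylGroupB
    (Equiv.ofBijective π (Finite.injective_iff_bijective.mp hinj)) hs
  refine ⟨w, hw, fun k => ?_⟩
  have heq : ψ.toLinearMap = w.toLinearEquiv.toLinearMap :=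
    (EuclideanSpace.basisFun (Fin n) ℝ).toBasis.ext fun i => by
      have := (hπ i).trans (hwh i).symm
      simpa [h] using this
  rw [← hψ]
  exact LinearMap.congr_fun heq (r k)

/-- Two irreducible systems of roots of type `Bₙ`, each containing a short root, that are
proportional up to an isometry differ by an element of the Weyl group, up to order and signs. -/
theorem exists_weylGroup_of_gram_smul {n : ℕ} {r r' : Fin n → E n}
    (hli : LinearIndependent ℝ r) (hli' : LinearIndependent ℝ r')
    (hirr : IsIrreducibleSystem r) (hirr' : IsIrreducibleSystem r')
    (hr : ∀ k, r k ∈ rootsB n) (hr' : ∀ k, r' k ∈ rootsB n)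
    (hs : ∃ k, r k ∈ shortB n) (hs' : ∃ k, r' k ∈ shortB n) {c : Fin n → ℝ}
    (hc : ∀ i, c i ≠ 0)
    (hgram : ∀ i j, inner ℝ (r' i) (r' j) = c i * c j * inner ℝ (r i) (r j)) :
    ∃ w ∈ weylGroup (rootsB n), ∃ τ : Equiv.Perm (Fin n),
      ∀ i, r' i = w (r (τ i)) ∨ r' i = -w (r (τ i)) := by
  have hL : ∀ i, h i ∈ AddSubgroup.closure (Set.range r) := by
    obtain ⟨k, hk⟩ := hs
    exact h_mem_of_isIrreducibleSystem hirr hr _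
      (fun k => Or.inl (AddSubgroup.subset_closure ⟨k, rfl⟩))
      ⟨r k, hk, AddSubgroup.subset_closure ⟨k, rfl⟩⟩
  have hnorm : ∀ i, ‖r' i‖ ^ 2 = c i ^ 2 * ‖r i‖ ^ 2 := by
    intro i
    rw [← real_inner_self_eq_norm_sq, hgram, real_inner_self_eq_norm_sq, sq (c i)]
  have hne : ∀ {u : Fin n → E n}, LinearIndependent ℝ u → ∀ {i j}, i ≠ j →
      u i ≠ u j ∧ u i ≠ -u j := by
    intro u hu i j hij
    refine ⟨fun hh => hij (hu.injective hh), fun hh => hij ?_⟩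
    exact hu.eq_of_smul_apply_eq_smul_apply 1 (-1) i j one_ne_zero (by simpa using hh)
  -- Otherwise both inner products are ±1, so `c i ^ 2 * c j ^ 2 = 1`.
  have hadj : ∀ i j, c i ^ 2 = 1 → c j ^ 2 ≠ 1 → inner ℝ (r i) (r j) = 0 := by
    intro i j hi hj
    by_contra h0
    have hij : i ≠ j := by rintro rfl; exact hj hi
    have h1 := inner_sq_eq_one_of_mem_rootsB (hr i) (hr j) (hne hli hij).1 (hne hli hij).2 h0
    have h2 := inner_sq_eq_one_of_mem_rootsB (hr' i) (hr' j) (hne hli' hij).1 (hne hli' hij).2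
      (by rw [hgram]; exact mul_ne_zero (mul_ne_zero (hc i) (hc j)) h0)
    rw [hgram, mul_pow, mul_pow, h1, hi, one_mul, mul_one] at h2
    exact hj h2
  have hfinish : ∀ (d : Fin n → ℝ) (τ : Equiv.Perm (Fin n)), (∀ i, d i = 1 ∨ d i = -1) →
      (∀ i j, d i * d j * inner ℝ (r' (τ i)) (r' (τ j)) = inner ℝ (r i) (r j)) →
      ∃ w ∈ weylGroup (rootsB n), ∃ τ : Equiv.Perm (Fin n),
        ∀ i, r' i = w (r (τ i)) ∨ r' i = -w (r (τ i)) := by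
    intro d τ hd hg
    obtain ⟨w, hw, hwr⟩ := exists_weylGroup_of_gram_eq hli (r' := fun i => d i • r' (τ i))
      (fun k => by
        rcases hd k with hk | hk <;> rw [hk]
        · rw [one_smul]; exact hr' _
        · rw [neg_smul, one_smul]; exact neg_mem_rootsB (hr' _)) hL
      (fun i j => by
        rw [real_inner_smul_left, real_inner_smul_right, ← mul_assoc]
        exact hg i j)
    refine ⟨w, hw, τ.symm, fun i => ?_⟩
    rw [← hwr]
    rcases hd (τ.symm i) with hi | hi <;> simp [hi]
  let V := Submodule.span ℝ (r '' {i | c i ^ 2 = 1})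
  have hmem : ∀ i, c i ^ 2 = 1 → r i ∈ V := fun i hi => Submodule.subset_span ⟨i, hi, rfl⟩
  have horth : ∀ j, c j ^ 2 ≠ 1 → r j ∈ Vᗮ := by
    intro j hj
    rw [Submodule.mem_orthogonal]
    intro x hx
    induction hx using Submodule.span_induction with
    | mem x hx => obtain ⟨i, hi, rfl⟩ := hx; exact hadj i j hi hj
    | zero => simp
    | add a b _ _ ha hb => rw [inner_add_left, ha, hb, add_zero]
    | smul c a _ ha => rw [real_inner_smul_left, ha, mul_zero]
  rcases hirr V fun k => (em _).imp (hmem k) (horth k) with hV | hV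
  -- The exceptional case: short and long are interchanged, and uniqueness of the short root on each
  -- side leaves only `i₀` and `i₁`.
  · have hall : ∀ i, c i ^ 2 ≠ 1 := by
      intro i hi
      have := hmem i hi
      rw [hV, Submodule.mem_bot] at this
      exact hli.ne_zero i this
    obtain ⟨i₀, hi₀⟩ := hs
    obtain ⟨i₁, hi₁⟩ := hs'
    have hc0 : ∀ i, r i ∈ shortB n → c i ^ 2 = 2 ∧ r' i ∈ longB n := by
      intro i hi
      have h1 := hnorm i
      rw [norm_sq_of_mem_shortB hi, mul_one] at h1
      rcases mem_rootsB.mp (hr' i) with h2 | h2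
      · rw [norm_sq_of_mem_shortB h2] at h1
        exact absurd h1.symm (hall i)
      · rw [norm_sq_of_mem_longB h2] at h1
        exact ⟨h1.symm, h2⟩
    have hc1 : ∀ i, r i ∈ longB n → c i ^ 2 = 1 / 2 ∧ r' i ∈ shortB n := by
      intro i hi
      have h1 := hnorm i
      rw [norm_sq_of_mem_longB hi] at h1
      rcases mem_rootsB.mp (hr' i) with h2 | h2
      · rw [norm_sq_of_mem_shortB h2] at h1
        exact ⟨by linarith, h2⟩
      · rw [norm_sq_of_mem_longB h2] at h1
        exact absurd (by linarith) (hall i)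
    have hshort : ∀ i, i ≠ i₀ → r i ∈ longB n := fun i hi =>
      (mem_rootsB.mp (hr i)).resolve_left fun hs => hi (eq_of_mem_shortB hli hirr hr hs hi₀)
    have hi₁' : r i₁ ∈ longB n := by
      refine (mem_rootsB.mp (hr i₁)).resolve_left fun hs => ?_
      have h1 := norm_sq_of_mem_longB (hc0 i₁ hs).2
      rw [norm_sq_of_mem_shortB hi₁] at h1
      norm_num at h1
    have hne01 : i₀ ≠ i₁ := by
      rintro rfl
      have h1 := norm_sq_of_mem_longB hi₁'
      rw [norm_sq_of_mem_shortB hi₀] at h1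
      norm_num at h1
    have htwo : ∀ i, i = i₀ ∨ i = i₁ := by
      intro i
      by_cases hi : i = i₀
      · exact Or.inl hi
      · exact Or.inr (eq_of_mem_shortB hli' hirr' hr' (hc1 i (hshort i hi)).2 hi₁)
    have e0 := (hc0 i₀ hi₀).1
    have e1 := (hc1 i₁ hi₁').1
    have hδ : (c i₀ * c i₁) ^ 2 = 1 := by rw [mul_pow, e0, e1]; norm_num
    have n0 := norm_sq_of_mem_shortB hi₀
    have n1 := norm_sq_of_mem_longB hi₁'
    -- The sign `c i₀ * c i₁` corrects the off-diagonal Gram entry after the swap.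
    refine hfinish (fun i => if i = i₀ then 1 else c i₀ * c i₁) (Equiv.swap i₀ i₁) ?_ ?_
    · intro i
      split_ifs
      · exact Or.inl rfl
      · exact sq_eq_one_iff.mp hδ
    · intro i j
      rcases htwo i with rfl | rfl <;> rcases htwo j with rfl | rfl <;>
        simp only [Equiv.swap_apply_left, Equiv.swap_apply_right, if_true, hne01.symm, if_false,
          hgram, real_inner_self_eq_norm_sq, n0, n1]
      · linear_combination 2 * e1
      · rw [real_inner_comm]
        linear_combination (inner ℝ (r i) (r j)) * hδ
      · rw [real_inner_comm]
        linear_combination (inner ℝ (r i) (r j)) * hδ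
      · linear_combination c i₀ ^ 2 * hδ + e0
  · have hall : ∀ i, c i ^ 2 = 1 := by
      intro i
      by_contra hi
      have := horth i hi
      rw [hV, Submodule.top_orthogonal_eq_bot, Submodule.mem_bot] at this
      exact hli.ne_zero i this
    refine hfinish c 1 (fun i => sq_eq_one_iff.mp (hall i)) fun i j => ?_
    rw [Equiv.Perm.one_apply, Equiv.Perm.one_apply, hgram]
    have h1 := hall i
    have h2 := hall j
    linear_combination (inner ℝ (r i) (r j)) * (c j ^ 2 * h1 + h2)

theorem hasUniqueEmbedding_B {n : ℕ} (hn : 2 ≤ n) {Φ : Set (Set (E n))} (hΦ : IsFamily Φ)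
    (hgen : Generates Φ (CoxeterMatrix.B n)) : HasUniqueEmbedding Φ (rootsB n) := by
  obtain ⟨R, hR⟩ := exists_isEmbedding_B hΦ hgen
  refine ⟨R, hR, ?_⟩
  obtain ⟨hRΔ, φ, f, hf, rfl⟩ := hR
  rintro R' ⟨hRΔ', φ', f', hf', rfl⟩
  obtain ⟨σ, c, hc, hcf⟩ := hf.exists_perm hf'
  have hr : ∀ i, φ (f i) ∈ rootsB n := fun i => hRΔ ⟨i, Or.inl rfl⟩
  have hr' : ∀ i, φ' (f' i) ∈ rootsB n := fun i => hRΔ' ⟨i, Or.inl rfl⟩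
  have hli : LinearIndependent ℝ fun i => φ (f i) :=
    hf.1.map' φ.toLinearMap (LinearMap.ker_eq_bot.mpr φ.injective)
  have hli' : LinearIndependent ℝ fun i => φ' (f' i) :=
    hf'.1.map' φ'.toLinearMap (LinearMap.ker_eq_bot.mpr φ'.injective)
  obtain ⟨k, hk⟩ := exists_mem_shortB hn hf hgen φ hr
  obtain ⟨w, hw, τ, hτ⟩ := exists_weylGroup_of_gram_smul (r := fun i => φ (f (σ i)))
    (hli.comp σ σ.injective) hli'
    (((isIrreducibleSystem_of_generates hf hgen).map φ).comp_perm σ)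
    ((isIrreducibleSystem_of_generates hf' hgen).map φ') (fun i => hr _) hr'
    ⟨σ.symm k, by simpa using hk⟩ (exists_mem_shortB hn hf' hgen φ' hr') hc (fun i j => by
      rw [φ'.inner_map_map, φ.inner_map_map, hcf, hcf, real_inner_smul_left,
        real_inner_smul_right, mul_assoc])
  exact ⟨w, hw, setOf_pm_eq_image (r := fun i => φ (f i)) (r' := fun i => φ' (f' i)) w
    (τ.trans σ) hτ⟩

end SphericalFamily

theorem mainTheorem6 :
    (∀ n : ℕ, 1 ≤ n → ∀ Φ : Set (Set (SphericalFamily.E n)),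
      SphericalFamily.IsFamily Φ →
      SphericalFamily.Generates Φ (CoxeterMatrix.A n) →
      SphericalFamily.HasUniqueEmbedding Φ (SphericalFamily.rootsA n)) ∧
    (∀ n : ℕ, 2 ≤ n → ∀ Φ : Set (Set (SphericalFamily.E n)),
      SphericalFamily.IsFamily Φ →
      SphericalFamily.Generates Φ (CoxeterMatrix.B n) →
      SphericalFamily.HasUniqueEmbedding Φ (SphericalFamily.rootsB n)) :=
  ⟨fun _ _ _ hΦ hgen => SphericalFamily.hasUniqueEmbedding_A hΦ hgen,
    fun _ hn _ hΦ hgen => SphericalFamily.hasUniqueEmbedding_B hn hΦ hgen⟩
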